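/- Let $V\subset\mathbb R^3=\{(x,y,z)\}$ be open and connected (for instance simply connected), and let $w>0$ and $u$ be smooth functions on $V$ with $w_{xx}+w_{yy}+(we^u)_{zz}=0$. Let $M=\mathbb R\times V$ and let $\omega$ be a smooth 1-form on $M$, non-vanishing on the $\mathbb R$-factor, with $$d\omega=w_x\,dy\wedge dz+w_y\,dz\wedge dx+(we^u)_z\,dx\wedge dy .$$ Put $g=e^uw(dx^2+dy^2)+w\,dz^2+w^{-1}\omega^2$ (LeBrun's metric) and let $J$ be the endomorphism field with $g(JX,Y)=\Omega_J(X,Y)$, where $\Omega_J=-dz\wedge\omega+e^uw\,dx\wedge dy$. Then $(g,J)$ is an almost Hermitian structure on $M$ with fundamental form $\Omega_J$. An almost Hermitian structure is called almost Kähler if its fundamental form is closed, and Kähler if moreover the Nijenhuis tensor of $J$ vanishes. The class $\mathcal{AK}_3$ consists of the almost Kähler structures whose curvature satisfies $R_{XYZW}=R_{JX\,JY\,JZ\,JW}$, and $\mathcal{AK}_2$ of those with $R_{XYZW}-R_{JX\,JY\,Z\,W}=R_{JX\,Y\,JZ\,W}+R_{JX\,Y\,Z\,JW}$, for all tangent vectors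 $X,Y,Z,W$. The structure $(g,J)$ is almost Kähler if and only if $(e^uw)_z=0$ on $V$. It is Kähler if and only if moreover $w$ does not depend on $x$ and $y$, that is, $w_x=w_y=0$ on $V$. Furthermore: (i) $(M,g,J)$ is non-Kähler and belongs to $\mathcal{AK}_3$ if and only if $w$ is a non-constant (positive) harmonic function of $(x,y)$ and $u$ is an (arbitrary) function of $(x,y)$, that is, $w_z=u_z=0$ and $w_{xx}+w_{yy}=0$ on $V$, and $w$ is not constant. (ii) $(M,g,J)$ is non-Kähler and belongs to $\mathcal{AK}_2$ if and only if, in addition to the conditions in (i), $w$ has no critical points and $u=\ln(w_x^2+w_y^2)-3\ln w+\mathrm{const}$. If all the slices $\{z:(x,y,z)\in V\}$ are connected (for instance if $V=U\times(a,b)$), then the condition in (i) is equivalent to the following: on the projection $U$ of $V$ to the $(x,y)$-plane there are a non-constant positive harmonic function and a smooth function whose pullbacks to $V$ are $w$ and $u$ respectively; and similarly in (ii), where the absence of critical points and the formula for $u$ refer to these functions on $U$. -/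

import Mathlib

open scoped ContDiff Matrix

noncomputable section

namespace LeBrunAK

/-- The partial derivative of `f` in the `i`-th coordinate direction of `ℝⁿ`. -/
def pd {n : ℕ} (i : Fin n) (f : (Fin n → ℝ) → ℝ) (p : Fin n → ℝ) : ℝ :=
  fderiv ℝ f p (Pi.single i 1)

/-! ### Tensor fields on open subsets of `ℝⁿ`, in the global coordinates

A 1-form is given by its components `α p i = α(∂ᵢ)`, a bilinear form by
`B p i j = B(∂ᵢ, ∂ⱼ)`, and an endomorphism field by `J ∂ⱼ = ∑ᵢ (J p i j) ∂ᵢ`. -/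

/-- The exterior derivative of a 1-form: `(dα)ᵢⱼ = ∂ᵢαⱼ - ∂ⱼαᵢ`. -/
def d₁ {n : ℕ} (α : (Fin n → ℝ) → Fin n → ℝ) (p : Fin n → ℝ) :
    Matrix (Fin n) (Fin n) ℝ :=
  Matrix.of fun i j => pd i (fun q => α q j) p - pd j (fun q => α q i) p

/-- The exterior derivative of a 2-form: `(dΩ)ᵢⱼₖ = ∂ᵢΩⱼₖ + ∂ⱼΩₖᵢ + ∂ₖΩᵢⱼ`. -/
def d₂ {n : ℕ} (Ω : (Fin n → ℝ) → Matrix (Fin n) (Fin n) ℝ) (p : Fin n → ℝ)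
    (i j k : Fin n) : ℝ :=
  pd i (fun q => Ω q j k) p + pd j (fun q => Ω q k i) p + pd k (fun q => Ω q i j) p

/-- The wedge product of two covectors: `(α ∧ β)(X, Y) = α(X) β(Y) - α(Y) β(X)`. -/
def wedge {n : ℕ} (α β : Fin n → ℝ) : Matrix (Fin n) (Fin n) ℝ :=
  Matrix.of fun i j => α i * β j - α j * β i

/-- The square of a covector as a symmetric bilinear form: `α²(X, Y) = α(X) α(Y)`. -/
def sqForm {n : ℕ} (α : Fin n → ℝ) : Matrix (Fin n) (Fin n) ℝ :=
  Matrix.of fun i j => α i * α j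

/-- The Christoffel symbols `Γᵏᵢⱼ` of the Levi-Civita connection of `g`:
`∇_{∂ᵢ} ∂ⱼ = ∑ₖ Γᵏᵢⱼ ∂ₖ`. -/
def christoffel {n : ℕ} (g : (Fin n → ℝ) → Matrix (Fin n) (Fin n) ℝ) (k i j : Fin n)
    (p : Fin n → ℝ) : ℝ :=
  (1 / 2) * ∑ l, (g p)⁻¹ k l *
    (pd i (fun q => g q j l) p + pd j (fun q => g q i l) p - pd l (fun q => g q i j) p)

/-- The components of the Riemannian curvature:
`R(∂ᵢ, ∂ⱼ) ∂ₖ = ∇_{∂ᵢ} ∇_{∂ⱼ} ∂ₖ - ∇_{∂ⱼ} ∇_{∂ᵢ} ∂ₖ = ∑ₗ (curvUp g l i j k) ∂ₗ`. -/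
def curvUp {n : ℕ} (g : (Fin n → ℝ) → Matrix (Fin n) (Fin n) ℝ) (l i j k : Fin n)
    (p : Fin n → ℝ) : ℝ :=
  pd i (christoffel g l j k) p - pd j (christoffel g l i k) p +
    ∑ m, (christoffel g m j k p * christoffel g l i m p -
      christoffel g m i k p * christoffel g l j m p)

/-- The Riemannian curvature at `p` as a 4-linear form:
`R_{XYZW} = g(R(X, Y) Z, W)`. -/
def Rm {n : ℕ} (g : (Fin n → ℝ) → Matrix (Fin n) (Fin n) ℝ) (p : Fin n → ℝ)
    (X Y Z W : Fin n → ℝ) : ℝ :=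
  ∑ i, ∑ j, ∑ k, ∑ l, (∑ m, curvUp g m i j k p * g p m l) * X i * Y j * Z k * W l

/-- The components of the Nijenhuis tensor
`N(X, Y) = [JX, JY] - J[JX, Y] - J[X, JY] - [X, Y]`: `N(∂ᵢ, ∂ⱼ) = ∑ₖ (nijenhuis J k i j) ∂ₖ`. -/
def nijenhuis {n : ℕ} (J : (Fin n → ℝ) → Matrix (Fin n) (Fin n) ℝ) (k i j : Fin n)
    (p : Fin n → ℝ) : ℝ :=
  ∑ l, (J p l i * pd l (fun q => J q k j) p - J p l j * pd l (fun q => J q k i) p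
    - J p k l * (pd i (fun q => J q l j) p - pd j (fun q => J q l i) p))

/-! ### Almost Hermitian geometry on an open set `M ⊆ ℝⁿ` -/

/-- `(g, J)` is a smooth almost Hermitian structure on `M`: `g` is a Riemannian metric and
`J` a `g`-orthogonal almost complex structure. -/
structure IsAlmostHermitianOn {n : ℕ} (M : Set (Fin n → ℝ))
    (g J : (Fin n → ℝ) → Matrix (Fin n) (Fin n) ℝ) : Prop where
  smooth_metric : ∀ i j, ContDiffOn ℝ ∞ (fun p => g p i j) M
  posDef : ∀ p ∈ M, (g p).PosDef
  smooth_J : ∀ i j, ContDiffOn ℝ ∞ (fun p => J p i j) M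
  J_sq : ∀ p ∈ M, J p * J p = -1
  orthogonal : ∀ p ∈ M, (J p)ᵀ * g p * J p = g p

/-- The fundamental 2-form `Ω(X, Y) = g(JX, Y)`. -/
def fundamentalForm {n : ℕ} (g J : (Fin n → ℝ) → Matrix (Fin n) (Fin n) ℝ)
    (p : Fin n → ℝ) : Matrix (Fin n) (Fin n) ℝ :=
  (J p)ᵀ * g p

/-- The endomorphism field `J` with `g(JX, Y) = Ω(X, Y)`. -/
def endOfForm {n : ℕ} (g Ω : (Fin n → ℝ) → Matrix (Fin n) (Fin n) ℝ)
    (p : Fin n → ℝ) : Matrix (Fin n) (Fin n) ℝ :=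
  (g p)⁻¹ * (Ω p)ᵀ

/-- Almost Kähler: almost Hermitian with closed fundamental form. -/
def IsAlmostKahlerOn {n : ℕ} (M : Set (Fin n → ℝ))
    (g J : (Fin n → ℝ) → Matrix (Fin n) (Fin n) ℝ) : Prop :=
  IsAlmostHermitianOn M g J ∧ ∀ p ∈ M, ∀ i j k, d₂ (fundamentalForm g J) p i j k = 0

/-- Kähler: almost Kähler with integrable `J`, that is, with vanishing Nijenhuis tensor. -/
def IsKahlerOn {n : ℕ} (M : Set (Fin n → ℝ))
    (g J : (Fin n → ℝ) → Matrix (Fin n) (Fin n) ℝ) : Prop :=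
  IsAlmostKahlerOn M g J ∧ ∀ p ∈ M, ∀ i j k, nijenhuis J k i j p = 0

/-- The second Gray condition: `R_{XYZW} - R_{JXJYZW} = R_{JXYJZW} + R_{JXYZJW}`. -/
def Gray2On {n : ℕ} (M : Set (Fin n → ℝ))
    (g J : (Fin n → ℝ) → Matrix (Fin n) (Fin n) ℝ) : Prop :=
  ∀ p ∈ M, ∀ X Y Z W : Fin n → ℝ,
    Rm g p X Y Z W - Rm g p (J p *ᵥ X) (J p *ᵥ Y) Z W =
      Rm g p (J p *ᵥ X) Y (J p *ᵥ Z) W + Rm g p (J p *ᵥ X) Y Z (J p *ᵥ W)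

/-- The third Gray condition: `R_{XYZW} = R_{JXJYJZJW}`. -/
def Gray3On {n : ℕ} (M : Set (Fin n → ℝ))
    (g J : (Fin n → ℝ) → Matrix (Fin n) (Fin n) ℝ) : Prop :=
  ∀ p ∈ M, ∀ X Y Z W : Fin n → ℝ,
    Rm g p X Y Z W = Rm g p (J p *ᵥ X) (J p *ᵥ Y) (J p *ᵥ Z) (J p *ᵥ W)

/-- The class `𝒜𝒦₂`: almost Kähler structures satisfying the second Gray condition. -/
def IsAK2On {n : ℕ} (M : Set (Fin n → ℝ))
    (g J : (Fin n → ℝ) → Matrix (Fin n) (Fin n) ℝ) : Prop :=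
  IsAlmostKahlerOn M g J ∧ Gray2On M g J

/-- The class `𝒜𝒦₃`: almost Kähler structures satisfying the third Gray condition. -/
def IsAK3On {n : ℕ} (M : Set (Fin n → ℝ))
    (g J : (Fin n → ℝ) → Matrix (Fin n) (Fin n) ℝ) : Prop :=
  IsAlmostKahlerOn M g J ∧ Gray3On M g J

/-! ### LeBrun's metric

A point of `ℝ³` is `(x, y, z)` with indices `0, 1, 2`; a point of `ℝ⁴ = ℝ × ℝ³` is
`(t, x, y, z)` with indices `0, 1, 2, 3`. -/

/-- The projection `ℝ × ℝ³ → ℝ³`, `(t, x, y, z) ↦ (x, y, z)`. -/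
def pr (p : Fin 4 → ℝ) : Fin 3 → ℝ := fun i => p i.succ

/-- The manifold `M = ℝ × V`. -/
def total (V : Set (Fin 3 → ℝ)) : Set (Fin 4 → ℝ) := {p | pr p ∈ V}

/-- The coordinate 1-form `dx` on `ℝ⁴`. -/
def dx : Fin 4 → ℝ := Pi.single 1 1

/-- The coordinate 1-form `dy` on `ℝ⁴`. -/
def dy : Fin 4 → ℝ := Pi.single 2 1

/-- The coordinate 1-form `dz` on `ℝ⁴`. -/
def dz : Fin 4 → ℝ := Pi.single 3 1

/-- The function `e^u w` on `ℝ³`. -/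
def expw (u w : (Fin 3 → ℝ) → ℝ) (q : Fin 3 → ℝ) : ℝ := Real.exp (u q) * w q

/-- LeBrun's metric `g = e^u w (dx² + dy²) + w dz² + w⁻¹ θ²`. -/
def metric (u w : (Fin 3 → ℝ) → ℝ) (θ : (Fin 4 → ℝ) → Fin 4 → ℝ) (p : Fin 4 → ℝ) :
    Matrix (Fin 4) (Fin 4) ℝ :=
  expw u w (pr p) • (sqForm dx + sqForm dy) + w (pr p) • sqForm dz
    + (w (pr p))⁻¹ • sqForm (θ p)

/-- The 2-form `Ω_J = - dz ∧ θ + e^u w dx ∧ dy`. -/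
def OmegaJ (u w : (Fin 3 → ℝ) → ℝ) (θ : (Fin 4 → ℝ) → Fin 4 → ℝ) (p : Fin 4 → ℝ) :
    Matrix (Fin 4) (Fin 4) ℝ :=
  -wedge dz (θ p) + expw u w (pr p) • wedge dx dy

/-- The endomorphism field `J` whose fundamental form with respect to `g` is `Ω_J`. -/
def JJ (u w : (Fin 3 → ℝ) → ℝ) (θ : (Fin 4 → ℝ) → Fin 4 → ℝ) :
    (Fin 4 → ℝ) → Matrix (Fin 4) (Fin 4) ℝ :=
  endOfForm (metric u w θ) (OmegaJ u w θ)

/-- The projection `(x, y, z) ↦ (x, y)`. -/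
def prXY (q : Fin 3 → ℝ) : Fin 2 → ℝ := ![q 0, q 1]

end LeBrunAK

end

open LeBrunAK

/-!
Everything is computed in the coframe `(e⁰, e¹, e², e³) = (θ, dx, dy, dz)`, with dual frame `Eₐ`. In
it the metric is diagonal, `diag (w⁻¹, h, h, w)` with `h = e^u w`; moreover `J E₀ = w⁻¹ E₃`,
`J E₁ = E₂`, and only `e⁰` has a nonzero exterior derivative. All coefficients are pulled back from
`V`, and `E₀` kills such functions while `E₁, E₂, E₃` act as `∂ₓ, ∂_y, ∂_z`; so `θ` drops out of
the computation although it is only known through `dθ`.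

* `dΩ_J = 2 h_z dz ∧ dx ∧ dy` (`d₂_fundamentalForm`) gives the almost Kähler condition `h_z = 0`.
  The Nijenhuis tensor (`nijenhuis_JJ_values`) vanishes exactly when moreover `w_x = w_y = 0`.
* The Christoffel symbols are the gauge transform by the coframe matrix of any torsion-free metric
  connection written in the frame (`IsLeviCivitaCoframe.mul_chrM`), so the curvature tensor can be
  computed there (`IsLeviCivitaCoframe.Rm_eq`). If `h_z = 0`, then `w` is harmonic in `(x, y)`, and
  the curvature depends on seven functions only (`frameCurv_eq_curvTable`).
* The third Gray condition becomes `(w_z / w²)_x = (w_z / w²)_y = 0` (`gray₃On_iff`). With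
  `v = 1 / w`, harmonicity of `w` reads `v (v_xx + v_yy) = 2 (v_x² + v_y²)`, where now only the
  factor `v` depends on `z`; differentiation yields `w_z (w_x² + w_y²) = 0`
  (`pd_two_mul_grad_eq_zero`). In each horizontal plane `w_x - i w_y` is holomorphic, so by the
  identity theorem the set where it is nonzero is dense in `V` as soon as it is nonempty, whence
  `w_z = 0` (`pd_two_eq_zero`).
* The second Gray condition adds two equations linear in `u_x, u_y`, equivalent to
  `d ((w_x² + w_y²) e^{-u} w⁻³) = 0` away from the zeros of `w_x - i w_y`; a nonzero constant
  `(w_x² + w_y²) e^{-u} w⁻³` leaves no zeros (`gray₂_equations_iff`).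
* Functions with vanishing `z`-derivative are constant on connected vertical slices and hence
  descend to the plane (`exists_descent`).
-/

open scoped ContDiff Matrix
open LeBrunAK

namespace LeBrunAK

/-! ### Calculus of coordinate derivatives -/

section Calculus

variable {n : ℕ} {f g : (Fin n → ℝ) → ℝ} {p : Fin n → ℝ} {M : Set (Fin n → ℝ)}

theorem pd_congr (i : Fin n) (h : f =ᶠ[nhds p] g) : pd i f p = pd i g p := by
  simp only [pd, h.fderiv_eq]

theorem pd_congr_on (hM : IsOpen M) (h : ∀ q ∈ M, f q = g q) (hp : p ∈ M) (i : Fin n) :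
    pd i f p = pd i g p :=
  pd_congr i (Filter.eventuallyEq_of_mem (hM.mem_nhds hp) h)

@[simp] theorem pd_const (i : Fin n) (c : ℝ) : pd i (fun _ => c) p = 0 := by
  simp [pd]

theorem pd_add (i : Fin n) (hf : DifferentiableAt ℝ f p) (hg : DifferentiableAt ℝ g p) :
    pd i (fun q => f q + g q) p = pd i f p + pd i g p := by
  simp only [pd, fderiv_fun_add hf hg, add_apply]

theorem pd_sub (i : Fin n) (hf : DifferentiableAt ℝ f p) (hg : DifferentiableAt ℝ g p) :
    pd i (fun q => f q - g q) p = pd i f p - pd i g p := by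
  simp only [pd, fderiv_fun_sub hf hg, sub_apply]

theorem pd_neg (i : Fin n) : pd i (fun q => -f q) p = -pd i f p := by
  simp only [pd, fderiv_fun_neg, neg_apply]

theorem pd_mul (i : Fin n) (hf : DifferentiableAt ℝ f p) (hg : DifferentiableAt ℝ g p) :
    pd i (fun q => f q * g q) p = pd i f p * g p + f p * pd i g p := by
  simp only [pd, fderiv_fun_mul hf hg, add_apply, smul_apply, smul_eq_mul]
  ring

theorem pd_pow (i : Fin n) (hf : DifferentiableAt ℝ f p) (k : ℕ) :
    pd i (fun q => f q ^ k) p = k * f p ^ (k - 1) * pd i f p := by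
  simp only [pd, (hf.hasFDerivAt.pow k).fderiv, smul_apply, smul_eq_mul, nsmul_eq_mul]

theorem pd_inv (i : Fin n) (hf : DifferentiableAt ℝ f p) (h0 : f p ≠ 0) :
    pd i (fun q => (f q)⁻¹) p = -pd i f p / f p ^ 2 := by
  have h := (hasDerivAt_inv h0).comp_hasFDerivAt p hf.hasFDerivAt
  have e : pd i (fun q => (f q)⁻¹) p = _ := congrArg (fun L => L (Pi.single i 1)) h.fderiv
  rw [e]
  simp only [smul_apply, smul_eq_mul, pd]
  field_simp

theorem pd_div (i : Fin n) (hf : DifferentiableAt ℝ f p) (hg : DifferentiableAt ℝ g p)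
    (h0 : g p ≠ 0) :
    pd i (fun q => f q / g q) p = (pd i f p * g p - f p * pd i g p) / g p ^ 2 := by
  simp only [div_eq_mul_inv (f _)]
  rw [pd_mul i hf (hg.fun_inv h0), pd_inv i hg h0]
  field_simp
  ring

theorem pd_exp (i : Fin n) (hf : DifferentiableAt ℝ f p) :
    pd i (fun q => Real.exp (f q)) p = Real.exp (f p) * pd i f p := by
  simp only [pd, (hf.hasFDerivAt.exp).fderiv, smul_apply, smul_eq_mul]

theorem pd_log (i : Fin n) (hf : DifferentiableAt ℝ f p) (h0 : f p ≠ 0) :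
    pd i (fun q => Real.log (f q)) p = pd i f p / f p := by
  simp only [pd, (hf.hasFDerivAt.log h0).fderiv, smul_apply, smul_eq_mul]
  ring

theorem pd_sum {ι : Type*} (s : Finset ι) (i : Fin n) {F : ι → (Fin n → ℝ) → ℝ}
    (hF : ∀ a ∈ s, DifferentiableAt ℝ (F a) p) :
    pd i (fun q => ∑ a ∈ s, F a q) p = ∑ a ∈ s, pd i (F a) p := by
  simp only [pd, fderiv_fun_sum hF, sum_apply]

theorem contDiffOn_pd (hM : IsOpen M) (hf : ContDiffOn ℝ ∞ f M) (i : Fin n) :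
    ContDiffOn ℝ ∞ (pd i f) M := by
  have h := hf.fderiv_of_isOpen hM (m := ∞) (by simp)
  exact h.clm_apply contDiffOn_const

theorem differentiableAt_of_smooth (hM : IsOpen M) (hf : ContDiffOn ℝ ∞ f M) (hp : p ∈ M) :
    DifferentiableAt ℝ f p :=
  (hf.contDiffAt (hM.mem_nhds hp)).differentiableAt (by simp)

theorem pd_comm (hM : IsOpen M) (hf : ContDiffOn ℝ ∞ f M) (hp : p ∈ M) (i j : Fin n) :
    pd i (pd j f) p = pd j (pd i f) p := by
  have hc := hf.contDiffAt (hM.mem_nhds hp)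
  have hs : IsSymmSndFDerivAt ℝ f p := hc.isSymmSndFDerivAt (by
    rw [minSmoothness_of_isRCLikeNormedField]
    exact WithTop.coe_le_coe.mpr le_top)
  have hd : DifferentiableAt ℝ (fderiv ℝ f) p :=
    (hc.fderiv_right (m := 1) (by norm_cast)).differentiableAt (by simp)
  have key : ∀ a b : Fin n, pd a (pd b f) p
      = fderiv ℝ (fderiv ℝ f) p (Pi.single a 1) (Pi.single b 1) := by
    intro a b
    have : fderiv ℝ (fun q => fderiv ℝ f q (Pi.single b 1)) p
        = (fderiv ℝ (fderiv ℝ f) p).flip (Pi.single b 1) := by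
      rw [fderiv_clm_apply hd (by fun_prop)]
      simp
    simp only [pd] at this ⊢
    change fderiv ℝ (fun q => fderiv ℝ f q (Pi.single b 1)) p _ = _
    rw [this]
    rfl
  rw [key, key]
  exact hs _ _

end Calculus

/-! ### The Levi-Civita connection and the curvature in a coframe -/

section Coframe

variable {n : ℕ} {p : Fin n → ℝ} {M : Set (Fin n → ℝ)}

/-- The entrywise coordinate derivative of a matrix-valued function. -/
noncomputable def pdM (i : Fin n) (A : (Fin n → ℝ) → Matrix (Fin n) (Fin n) ℝ) (p : Fin n → ℝ) :
    Matrix (Fin n) (Fin n) ℝ :=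
  Matrix.of fun a b => pd i (fun q => A q a b) p

/-- Differentiability of all entries of a matrix-valued function. -/
def EntryDiffAt (A : (Fin n → ℝ) → Matrix (Fin n) (Fin n) ℝ) (p : Fin n → ℝ) : Prop :=
  ∀ a b, DifferentiableAt ℝ (fun q => A q a b) p

variable {A B : (Fin n → ℝ) → Matrix (Fin n) (Fin n) ℝ}

theorem EntryDiffAt.mul (hA : EntryDiffAt A p) (hB : EntryDiffAt B p) :
    EntryDiffAt (fun q => A q * B q) p := fun a b => by
  simp only [Matrix.mul_apply]
  exact DifferentiableAt.fun_sum fun c _ => (hA a c).fun_mul (hB c b)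

theorem EntryDiffAt.transpose (hA : EntryDiffAt A p) : EntryDiffAt (fun q => (A q)ᵀ) p :=
  fun a b => hA b a

theorem pdM_mul (hA : EntryDiffAt A p) (hB : EntryDiffAt B p) (i : Fin n) :
    pdM i (fun q => A q * B q) p = pdM i A p * B p + A p * pdM i B p := by
  ext a b
  simp only [pdM, Matrix.mul_apply, Matrix.of_apply, Matrix.add_apply]
  rw [pd_sum _ _ fun c _ => (hA a c).fun_mul (hB c b), ← Finset.sum_add_distrib]
  exact Finset.sum_congr rfl fun c _ => pd_mul i (hA a c) (hB c b)

theorem pdM_add (hA : EntryDiffAt A p) (hB : EntryDiffAt B p) (i : Fin n) :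
    pdM i (fun q => A q + B q) p = pdM i A p + pdM i B p := by
  ext a b
  exact pd_add i (hA a b) (hB a b)

theorem pdM_transpose (i : Fin n) : pdM i (fun q => (A q)ᵀ) p = (pdM i A p)ᵀ := rfl

theorem pdM_congr_on (hM : IsOpen M) (h : ∀ q ∈ M, A q = B q) (hp : p ∈ M) (i : Fin n) :
    pdM i A p = pdM i B p := by
  ext a b
  exact pd_congr_on hM (fun q hq => by rw [h q hq]) hp i

/-- The Christoffel symbols `Γᵏᵢⱼ` as the matrix `(k, j)` of `∇_{∂ᵢ}`. -/
noncomputable def chrM (g : (Fin n → ℝ) → Matrix (Fin n) (Fin n) ℝ) (i : Fin n) (p : Fin n → ℝ) :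
    Matrix (Fin n) (Fin n) ℝ :=
  Matrix.of fun k j => christoffel g k i j p

/-- The curvature operator `R(∂ᵢ, ∂ⱼ)` as a matrix in the coordinate frame. -/
noncomputable def curvM (g : (Fin n → ℝ) → Matrix (Fin n) (Fin n) ℝ) (i j : Fin n) (p : Fin n → ℝ) :
    Matrix (Fin n) (Fin n) ℝ :=
  Matrix.of fun l k => curvUp g l i j k p

theorem curvM_eq (g : (Fin n → ℝ) → Matrix (Fin n) (Fin n) ℝ) (i j : Fin n) (p : Fin n → ℝ) :
    curvM g i j p = pdM i (chrM g j) p - pdM j (chrM g i) p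
      + (chrM g i p * chrM g j p - chrM g j p * chrM g i p) := by
  ext l k
  simp only [curvM, curvUp, pdM, chrM, Matrix.of_apply, Matrix.add_apply, Matrix.sub_apply,
    Matrix.mul_apply, Finset.sum_sub_distrib]
  congr 2
  all_goals exact Finset.sum_congr rfl fun m _ => mul_comm _ _

/-- Uniqueness of the Levi-Civita connection: a torsion-free connection `Γ` for which `g` is
parallel has the Christoffel symbols of `g`. -/
theorem chrM_unique {g : (Fin n → ℝ) → Matrix (Fin n) (Fin n) ℝ}
    {Γ : Fin n → Matrix (Fin n) (Fin n) ℝ} (hsymm : (g p)ᵀ = g p) (hdet : IsUnit (g p).det)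
    (htor : ∀ k i j, Γ i k j = Γ j k i)
    (hpar : ∀ i, pdM i g p = (Γ i)ᵀ * g p + g p * Γ i) (i : Fin n) :
    chrM g i p = Γ i := by
  have hd : ∀ i j l, pd i (fun q => g q j l) p
      = ∑ m, Γ i m j * g p m l + ∑ m, g p j m * Γ i m l := fun i j l => by
    simpa [pdM, Matrix.mul_apply] using congrFun (congrFun (hpar i) j) l
  have hs : ∀ a b, g p a b = g p b a := fun a b => congrFun (congrFun hsymm b) a
  have key : ∀ j l, pd i (fun q => g q j l) p + pd j (fun q => g q i l) p
      - pd l (fun q => g q i j) p = 2 * (g p * Γ i) l j := fun j l => by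
    rw [hd, hd, hd, Matrix.mul_apply, two_mul, ← Finset.sum_add_distrib,
      ← Finset.sum_add_distrib, ← Finset.sum_add_distrib, ← Finset.sum_add_distrib,
      ← Finset.sum_add_distrib, ← Finset.sum_sub_distrib]
    refine Finset.sum_congr rfl fun m _ => ?_
    rw [htor m j i, htor m l i, htor m l j, hs j m, hs i m, hs l m]
    ring
  ext k j
  have : christoffel g k i j p = ((g p)⁻¹ * (g p * Γ i)) k j := by
    simp only [christoffel, key, Matrix.mul_apply (M := (g p)⁻¹), Finset.mul_sum]
    exact Finset.sum_congr rfl fun m _ => by ring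
  rw [chrM, Matrix.of_apply, this, ← Matrix.mul_assoc, Matrix.nonsing_inv_mul _ hdet,
    Matrix.one_mul]

end Coframe

section Coframe

variable {n : ℕ} {p : Fin n → ℝ} {M : Set (Fin n → ℝ)}

/-- Smoothness on `M` of all entries of a matrix-valued function. -/
def EntrySmoothOn (A : (Fin n → ℝ) → Matrix (Fin n) (Fin n) ℝ) (M : Set (Fin n → ℝ)) : Prop :=
  ∀ a b, ContDiffOn ℝ ∞ (fun q => A q a b) M

variable {A B : (Fin n → ℝ) → Matrix (Fin n) (Fin n) ℝ}

theorem EntrySmoothOn.entryDiffAt (hA : EntrySmoothOn A M) (hM : IsOpen M) (hp : p ∈ M) :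
    EntryDiffAt A p := fun a b => differentiableAt_of_smooth hM (hA a b) hp

theorem EntrySmoothOn.mul (hA : EntrySmoothOn A M) (hB : EntrySmoothOn B M) :
    EntrySmoothOn (fun q => A q * B q) M := fun a b => by
  simp only [Matrix.mul_apply]
  exact ContDiffOn.sum fun c _ => (hA a c).mul (hB c b)

theorem EntrySmoothOn.add (hA : EntrySmoothOn A M) (hB : EntrySmoothOn B M) :
    EntrySmoothOn (fun q => A q + B q) M := fun a b => (hA a b).add (hB a b)

theorem EntrySmoothOn.transpose (hA : EntrySmoothOn A M) : EntrySmoothOn (fun q => (A q)ᵀ) M :=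
  fun a b => hA b a

theorem EntrySmoothOn.pdM (hM : IsOpen M) (hA : EntrySmoothOn A M) (i : Fin n) :
    EntrySmoothOn (pdM i A) M := fun a b => contDiffOn_pd hM (hA a b) i

theorem EntrySmoothOn.congr (hA : EntrySmoothOn A M) (h : ∀ q ∈ M, B q = A q) :
    EntrySmoothOn B M := fun a b => (hA a b).congr fun q hq => by rw [h q hq]

theorem EntrySmoothOn.det (hA : EntrySmoothOn A M) : ContDiffOn ℝ ∞ (fun q => (A q).det) M := by
  simp only [Matrix.det_apply']
  exact ContDiffOn.sum fun σ _ => contDiffOn_const.mul (contDiffOn_prod fun i _ => hA _ _)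

theorem EntrySmoothOn.inv (hA : EntrySmoothOn A M) (hdet : ∀ q ∈ M, IsUnit (A q).det) :
    EntrySmoothOn (fun q => (A q)⁻¹) M := fun a b => by
  have hadj : ContDiffOn ℝ ∞ (fun q => (A q).adjugate a b) M := by
    simp only [Matrix.adjugate_apply]
    refine EntrySmoothOn.det (A := fun q => (A q).updateRow b (Pi.single a 1)) fun c d => ?_
    by_cases h : c = b
    · subst h
      simp only [Matrix.updateRow_self]
      exact contDiffOn_const
    · simp only [Matrix.updateRow_ne h]
      exact hA c d
  simp only [Matrix.inv_def, Ring.inverse_eq_inv', Matrix.smul_apply, smul_eq_mul]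
  exact (hA.det.inv fun q hq => (hdet q hq).ne_zero).mul hadj

theorem sum_comm₄ (F : Fin n → Fin n → Fin n → Fin n → Fin n → ℝ) :
    ∑ i, ∑ j, ∑ k, ∑ l, ∑ a, F i j k l a = ∑ a, ∑ i, ∑ j, ∑ k, ∑ l, F i j k l a := by
  have h : ∀ i j, ∑ k, ∑ l, ∑ a, F i j k l a = ∑ a, ∑ k, ∑ l, F i j k l a := fun i j =>
    (Finset.sum_congr rfl fun k _ => Finset.sum_comm).trans Finset.sum_comm
  simp only [h]
  exact (Finset.sum_congr rfl fun k _ => Finset.sum_comm).trans Finset.sum_comm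

/-- The curvature operator `R(Eₐ, E_b)` as a matrix in a frame, from the connection matrices `Om`,
the structure functions `T` of the coframe and the derivatives `dOm a b` of `Om b` along `Eₐ`. -/
def frameCurv (Om T : Fin n → Matrix (Fin n) (Fin n) ℝ)
    (dOm : Fin n → Fin n → Matrix (Fin n) (Fin n) ℝ) (a b : Fin n) : Matrix (Fin n) (Fin n) ℝ :=
  dOm a b - dOm b a + (Om a * Om b - Om b * Om a) + ∑ c, T c a b • Om c

theorem frameCurv_swap {Om T : Fin n → Matrix (Fin n) (Fin n) ℝ}
    {dOm : Fin n → Fin n → Matrix (Fin n) (Fin n) ℝ} (hT : ∀ c a b, T c b a = -T c a b)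
    (a b : Fin n) : frameCurv Om T dOm b a = -frameCurv Om T dOm a b := by
  simp only [frameCurv, hT _ a b, neg_smul, Finset.sum_neg_distrib]
  abel

theorem frameCurv_self {Om T : Fin n → Matrix (Fin n) (Fin n) ℝ}
    {dOm : Fin n → Fin n → Matrix (Fin n) (Fin n) ℝ} (hT : ∀ c a b, T c b a = -T c a b)
    (a : Fin n) : frameCurv Om T dOm a a = 0 := by
  ext c d
  exact self_eq_neg.mp (congrFun (congrFun (frameCurv_swap (dOm := dOm) (Om := Om) hT a a) c) d)

/-- Data expressing a metric `g = Pᵀ G P` in a coframe `eᵃ = ∑ᵢ (P a i) dxⁱ` with dual frame `Eₐ`: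
`Om a` is the matrix of `∇_{Eₐ}` in the frame, `T c` the matrix of `deᶜ` in the frame and
`dG a`, `dOm a b` are the derivatives of `G` and `Om b` along `Eₐ`. The last two conditions say that
the connection is torsion-free and metric. -/
structure IsLeviCivitaCoframe (M : Set (Fin n → ℝ))
    (g P G : (Fin n → ℝ) → Matrix (Fin n) (Fin n) ℝ)
    (Om T dG : Fin n → (Fin n → ℝ) → Matrix (Fin n) (Fin n) ℝ)
    (dOm : Fin n → Fin n → (Fin n → ℝ) → Matrix (Fin n) (Fin n) ℝ) : Prop where
  isOpen : IsOpen M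
  smooth_P : EntrySmoothOn P M
  smooth_G : EntrySmoothOn G M
  smooth_Om : ∀ a, EntrySmoothOn (Om a) M
  det_P : ∀ p ∈ M, IsUnit (P p).det
  det_G : ∀ p ∈ M, IsUnit (G p).det
  symm_G : ∀ p ∈ M, (G p)ᵀ = G p
  metric_eq : ∀ p ∈ M, g p = (P p)ᵀ * G p * P p
  pd_P : ∀ p ∈ M, ∀ i j c, pdM i P p c j - pdM j P p c i
    = ∑ a, ∑ b, T c p a b * P p a i * P p b j
  pd_G : ∀ p ∈ M, ∀ i, pdM i G p = ∑ a, P p a i • dG a p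
  pd_Om : ∀ p ∈ M, ∀ i b, pdM i (Om b) p = ∑ a, P p a i • dOm a b p
  torsion : ∀ p ∈ M, ∀ c a b, T c p a b = Om b p c a - Om a p c b
  parallel : ∀ p ∈ M, ∀ a, dG a p = (Om a p)ᵀ * G p + G p * Om a p

namespace IsLeviCivitaCoframe

variable {g P G : (Fin n → ℝ) → Matrix (Fin n) (Fin n) ℝ}
  {Om T dG : Fin n → (Fin n → ℝ) → Matrix (Fin n) (Fin n) ℝ}
  {dOm : Fin n → Fin n → (Fin n → ℝ) → Matrix (Fin n) (Fin n) ℝ}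

/-- The connection form `ω(∂ᵢ)` in the frame. -/
def conn (P : (Fin n → ℝ) → Matrix (Fin n) (Fin n) ℝ)
    (Om : Fin n → (Fin n → ℝ) → Matrix (Fin n) (Fin n) ℝ) (i : Fin n) (p : Fin n → ℝ) :
    Matrix (Fin n) (Fin n) ℝ := ∑ a, P p a i • Om a p

theorem smooth_conn (h : IsLeviCivitaCoframe M g P G Om T dG dOm) (i : Fin n) :
    EntrySmoothOn (conn P Om i) M := fun a b => by
  simp only [conn, Matrix.sum_apply, Matrix.smul_apply, smul_eq_mul]
  exact ContDiffOn.sum fun c _ => (h.smooth_P _ _).mul (h.smooth_Om _ _ _)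

/-- The connection forms are the gauge transform of the Christoffel symbols. -/
theorem mul_chrM (h : IsLeviCivitaCoframe M g P G Om T dG dOm) (hp : p ∈ M) (i : Fin n) :
    P p * chrM g i p = pdM i P p + conn P Om i p * P p := by
  have hPP : P p * (P p)⁻¹ = 1 := Matrix.mul_nonsing_inv _ (h.det_P p hp)
  have hPP' : (P p)⁻¹ * P p = 1 := Matrix.nonsing_inv_mul _ (h.det_P p hp)
  set Γ : Fin n → Matrix (Fin n) (Fin n) ℝ :=
    fun i => (P p)⁻¹ * (pdM i P p + conn P Om i p * P p) with hΓ
  have hPΓ : ∀ i, P p * Γ i = pdM i P p + conn P Om i p * P p := fun i => by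
    rw [hΓ, ← Matrix.mul_assoc, hPP, Matrix.one_mul]
  rw [chrM_unique (Γ := Γ), hPΓ]
  · rw [h.metric_eq p hp]
    simp only [Matrix.transpose_mul, Matrix.transpose_transpose, h.symm_G p hp, Matrix.mul_assoc]
  · rw [h.metric_eq p hp, Matrix.det_mul, Matrix.det_mul, Matrix.det_transpose]
    exact ((h.det_P p hp).mul (h.det_G p hp)).mul (h.det_P p hp)
  · intro k i j
    -- the torsion condition, transported to the coordinate frame by `P⁻¹`
    have key : ∀ c, (pdM i P p + conn P Om i p * P p) c j
        = (pdM j P p + conn P Om j p * P p) c i := fun c => by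
      have e := h.pd_P p hp i j c
      have e1 : ∀ i j, (conn P Om i p * P p) c j
          = ∑ a, ∑ b, Om a p c b * P p a i * P p b j := fun i j => by
        simp only [conn, Matrix.mul_apply, Matrix.sum_apply, Matrix.smul_apply, smul_eq_mul,
          Finset.sum_mul]
        rw [Finset.sum_comm]
        exact Finset.sum_congr rfl fun a _ => Finset.sum_congr rfl fun b _ => by ring
      have e2 : (conn P Om j p * P p) c i
          = ∑ a, ∑ b, Om b p c a * P p a i * P p b j := by
        rw [e1, Finset.sum_comm]
        exact Finset.sum_congr rfl fun a _ => Finset.sum_congr rfl fun b _ => by ring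
      rw [Matrix.add_apply, Matrix.add_apply, e1, e2]
      have e3 : ∑ a, ∑ b, T c p a b * P p a i * P p b j
          = ∑ a, ∑ b, Om b p c a * P p a i * P p b j
            - ∑ a, ∑ b, Om a p c b * P p a i * P p b j := by
        simp only [← Finset.sum_sub_distrib]
        exact Finset.sum_congr rfl fun a _ => Finset.sum_congr rfl fun b _ => by
          rw [h.torsion p hp]; ring
      linarith
    simp only [hΓ, Matrix.mul_apply (M := (P p)⁻¹), key]
  · intro i
    have hP := h.smooth_P.entryDiffAt h.isOpen hp
    have hG := h.smooth_G.entryDiffAt h.isOpen hp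
    have hGi : pdM i G p = (conn P Om i p)ᵀ * G p + G p * conn P Om i p := by
      rw [h.pd_G p hp]
      simp only [conn, Matrix.transpose_sum, Matrix.transpose_smul, Matrix.sum_mul, Matrix.mul_sum,
        Matrix.smul_mul, Matrix.mul_smul, ← Finset.sum_add_distrib, ← smul_add]
      exact Finset.sum_congr rfl fun a _ => by rw [h.parallel p hp]
    have e : pdM i P p = P p * Γ i - conn P Om i p * P p := by rw [hPΓ]; abel
    rw [pdM_congr_on h.isOpen h.metric_eq hp, pdM_mul (hP.transpose.mul hG) hP,
      pdM_mul hP.transpose hG, pdM_transpose, hGi, h.metric_eq p hp, e]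
    simp only [Matrix.transpose_sub, Matrix.transpose_mul, Matrix.sub_mul, Matrix.mul_sub,
      Matrix.add_mul, Matrix.mul_add, Matrix.mul_assoc]
    abel

theorem smooth_chrM (h : IsLeviCivitaCoframe M g P G Om T dG dOm) (i : Fin n) :
    EntrySmoothOn (chrM g i) M := by
  refine ((h.smooth_P.inv h.det_P).mul
    ((h.smooth_P.pdM h.isOpen i).add ((h.smooth_conn i).mul h.smooth_P))).congr fun q hq => ?_
  rw [← h.mul_chrM hq, ← Matrix.mul_assoc, Matrix.nonsing_inv_mul _ (h.det_P q hq), Matrix.one_mul]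

theorem pdM_conn_sub (h : IsLeviCivitaCoframe M g P G Om T dG dOm) (hp : p ∈ M) (i j : Fin n) :
    pdM i (conn P Om j) p - pdM j (conn P Om i) p
      = ∑ a, ∑ b, (P p a i * P p b j) •
        (dOm a b p - dOm b a p + ∑ c, T c p a b • Om c p) := by
  have hP := h.smooth_P.entryDiffAt h.isOpen hp
  have e : ∀ i j, pdM i (conn P Om j) p = ∑ c, pdM i P p c j • Om c p
      + ∑ a, ∑ b, (P p a i * P p b j) • dOm a b p := fun i j => by
    have : pdM i (conn P Om j) p
        = ∑ b, (pdM i P p b j • Om b p + P p b j • pdM i (Om b) p) := by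
      ext c d
      simp only [pdM, conn, Matrix.sum_apply, Matrix.smul_apply, Matrix.of_apply, smul_eq_mul,
        Matrix.add_apply]
      have hO := fun b => (h.smooth_Om b).entryDiffAt h.isOpen hp
      rw [pd_sum _ _ fun b _ => (hP b j).fun_mul (hO b c d)]
      exact Finset.sum_congr rfl fun b _ => pd_mul i (hP b j) (hO b c d)
    rw [this, Finset.sum_add_distrib, Finset.sum_comm (γ := Fin n)]
    congr 1
    refine Finset.sum_congr rfl fun b _ => ?_
    rw [h.pd_Om p hp, Finset.smul_sum]
    exact Finset.sum_congr rfl fun a _ => by rw [smul_smul, mul_comm]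
  have e2 : ∑ a, ∑ b, (P p a j * P p b i) • dOm a b p
      = ∑ a, ∑ b, (P p a i * P p b j) • dOm b a p := by
    rw [Finset.sum_comm]
    exact Finset.sum_congr rfl fun a _ => Finset.sum_congr rfl fun b _ => by rw [mul_comm]
  have e3 : ∑ c, pdM i P p c j • Om c p - ∑ c, pdM j P p c i • Om c p
      = ∑ a, ∑ b, (P p a i * P p b j) • ∑ c, T c p a b • Om c p := by
    simp only [← Finset.sum_sub_distrib, ← sub_smul, h.pd_P p hp i j, Finset.sum_smul,
      Finset.smul_sum, smul_smul]
    rw [Finset.sum_comm]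
    refine Finset.sum_congr rfl fun a _ => ?_
    rw [Finset.sum_comm]
    exact Finset.sum_congr rfl fun b _ => Finset.sum_congr rfl fun c _ => by congr 1; ring
  simp only [smul_add, smul_sub, Finset.sum_add_distrib, Finset.sum_sub_distrib, ← e3, ← e2]
  rw [e i j, e j i]
  abel

/-- The curvature in the coordinate frame and in the coframe are related by conjugation with
`P`. -/
theorem mul_curvM (h : IsLeviCivitaCoframe M g P G Om T dG dOm) (hp : p ∈ M) (i j : Fin n) :
    P p * curvM g i j p
      = (∑ a, ∑ b, (P p a i * P p b j) • frameCurv (Om · p) (T · p) (dOm · · p) a b) * P p := by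
  have hP := h.smooth_P.entryDiffAt h.isOpen hp
  have hΓ := fun i => (h.smooth_chrM i).entryDiffAt h.isOpen hp
  have hω := fun i => (h.smooth_conn i).entryDiffAt h.isOpen hp
  have hdP := fun i => (h.smooth_P.pdM h.isOpen i).entryDiffAt h.isOpen hp
  have e : ∀ i, pdM i P p = P p * chrM g i p - conn P Om i p * P p := fun i => by
    rw [h.mul_chrM hp]; abel
  -- differentiate `P Γⱼ = ∂ⱼP + ωⱼ P` in the direction `i`
  have key : ∀ i j, P p * pdM i (chrM g j) p = pdM i (pdM j P) p + pdM i (conn P Om j) p * P p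
      + conn P Om j p * (P p * chrM g i p - conn P Om i p * P p)
      - (P p * chrM g i p - conn P Om i p * P p) * chrM g j p := fun i j => by
    have := pdM_congr_on h.isOpen (fun q hq => h.mul_chrM hq j) hp i
    rw [pdM_mul hP (hΓ j), pdM_add (hdP j) ((hω j).mul hP), pdM_mul (hω j) hP, e i] at this
    rw [eq_sub_iff_add_eq, add_comm, this, add_assoc]
  have hsymm : pdM i (pdM j P) p = pdM j (pdM i P) p := by
    ext a b
    exact pd_comm h.isOpen (h.smooth_P a b) hp i j
  have hbr : conn P Om i p * conn P Om j p - conn P Om j p * conn P Om i p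
      = ∑ a, ∑ b, (P p a i * P p b j) • (Om a p * Om b p - Om b p * Om a p) := by
    simp only [conn, Finset.sum_mul_sum, smul_mul_smul_comm, smul_sub, Finset.sum_sub_distrib]
    congr 1
    rw [Finset.sum_comm]
    exact Finset.sum_congr rfl fun a _ => Finset.sum_congr rfl fun b _ => by rw [mul_comm]
  have hF : ∑ a, ∑ b, (P p a i * P p b j) • frameCurv (Om · p) (T · p) (dOm · · p) a b
      = pdM i (conn P Om j) p - pdM j (conn P Om i) p
        + (conn P Om i p * conn P Om j p - conn P Om j p * conn P Om i p) := by
    rw [h.pdM_conn_sub hp, hbr, ← Finset.sum_add_distrib]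
    refine Finset.sum_congr rfl fun a _ => ?_
    rw [← Finset.sum_add_distrib]
    refine Finset.sum_congr rfl fun b _ => ?_
    rw [← smul_add, frameCurv]
    congr 1
    abel
  rw [curvM_eq, hF, Matrix.mul_add, Matrix.mul_sub, key, key, hsymm]
  simp only [Matrix.sub_mul, Matrix.mul_sub, Matrix.add_mul, Matrix.mul_assoc]
  abel

/-- The curvature 4-tensor in terms of its components in the frame. -/
theorem Rm_eq (h : IsLeviCivitaCoframe M g P G Om T dG dOm) (hp : p ∈ M)
    (X Y Z W : Fin n → ℝ) :
    Rm g p X Y Z W = ∑ a, ∑ b, ∑ c, ∑ d, ((frameCurv (Om · p) (T · p) (dOm · · p) a b)ᵀ * G p) c d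
      * (P p *ᵥ X) a * (P p *ᵥ Y) b * (P p *ᵥ Z) c * (P p *ᵥ W) d := by
  have e1 : ∀ i j k l, ∑ m, curvUp g m i j k p * g p m l
      = ∑ a, ∑ b, ∑ c, ∑ d, P p a i * P p b j * P p c k * P p d l
        * ((frameCurv (Om · p) (T · p) (dOm · · p) a b)ᵀ * G p) c d := fun i j k l => by
    have : ∑ m, curvUp g m i j k p * g p m l = ((curvM g i j p)ᵀ * g p) k l := by
      simp [Matrix.mul_apply, curvM]
    rw [this, h.metric_eq p hp, ← Matrix.mul_assoc, ← Matrix.mul_assoc, ← Matrix.transpose_mul,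
      h.mul_curvM hp, Matrix.transpose_mul, Matrix.transpose_sum]
    simp only [Matrix.transpose_sum, Matrix.transpose_smul, Matrix.sum_mul, Matrix.mul_sum,
      Matrix.smul_mul, Matrix.mul_smul, Matrix.sum_apply, Matrix.smul_apply, smul_eq_mul]
    refine Finset.sum_congr rfl fun a _ => Finset.sum_congr rfl fun b _ => ?_
    rw [Matrix.mul_assoc (P p)ᵀ]
    simp only [Matrix.mul_apply (M := (P p)ᵀ * _), Matrix.mul_apply (M := (P p)ᵀ),
      Matrix.transpose_apply (P p), Finset.sum_mul, Finset.mul_sum]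
    rw [Finset.sum_comm]
    exact Finset.sum_congr rfl fun c _ => Finset.sum_congr rfl fun d _ => by ring
  simp only [Rm, e1, Finset.sum_mul]
  rw [sum_comm₄ fun i j k l a => ∑ b, ∑ c, ∑ d, P p a i * P p b j * P p c k * P p d l
    * ((frameCurv (Om · p) (T · p) (dOm · · p) a b)ᵀ * G p) c d * X i * Y j * Z k * W l]
  refine Finset.sum_congr rfl fun a _ => ?_
  rw [sum_comm₄ fun i j k l b => ∑ c, ∑ d, P p a i * P p b j * P p c k * P p d l
    * ((frameCurv (Om · p) (T · p) (dOm · · p) a b)ᵀ * G p) c d * X i * Y j * Z k * W l]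
  refine Finset.sum_congr rfl fun b _ => ?_
  rw [sum_comm₄ fun i j k l c => ∑ d, P p a i * P p b j * P p c k * P p d l
    * ((frameCurv (Om · p) (T · p) (dOm · · p) a b)ᵀ * G p) c d * X i * Y j * Z k * W l]
  refine Finset.sum_congr rfl fun c _ => ?_
  rw [sum_comm₄ fun i j k l d => P p a i * P p b j * P p c k * P p d l
    * ((frameCurv (Om · p) (T · p) (dOm · · p) a b)ᵀ * G p) c d * X i * Y j * Z k * W l]
  refine Finset.sum_congr rfl fun d _ => ?_
  simp only [Matrix.mulVec, dotProduct]
  rw [mul_assoc, mul_assoc, mul_assoc, Finset.sum_mul, Finset.mul_sum]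
  refine Finset.sum_congr rfl fun i _ => ?_
  rw [Finset.sum_mul, Finset.mul_sum, Finset.mul_sum]
  refine Finset.sum_congr rfl fun j _ => ?_
  rw [Finset.sum_mul, Finset.mul_sum, Finset.mul_sum, Finset.mul_sum]
  refine Finset.sum_congr rfl fun k _ => ?_
  simp only [Finset.mul_sum]
  exact Finset.sum_congr rfl fun l _ => by ring

end IsLeviCivitaCoframe

end Coframe

/-! ### The adapted coframe of LeBrun's metric -/

section Total

variable {V : Set (Fin 3 → ℝ)} {p : Fin 4 → ℝ} {f : (Fin 3 → ℝ) → ℝ}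

theorem contDiff_pr : ContDiff ℝ ∞ pr := by
  unfold pr
  fun_prop

theorem isOpen_total (hV : IsOpen V) : IsOpen (total V) := hV.preimage contDiff_pr.continuous

theorem smooth_comp_pr (hf : ContDiffOn ℝ ∞ f V) : ContDiffOn ℝ ∞ (fun p => f (pr p)) (total V) :=
  hf.comp contDiff_pr.contDiffOn fun _ h => h

theorem fderiv_comp_pr (hf : DifferentiableAt ℝ f (pr p)) (v : Fin 4 → ℝ) :
    fderiv ℝ (fun q => f (pr q)) p v = fderiv ℝ f (pr p) (pr v) := by
  have hL : HasFDerivAt pr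
      (ContinuousLinearMap.pi fun i : Fin 3 => ContinuousLinearMap.proj (R := ℝ) i.succ) p :=
    (ContinuousLinearMap.pi fun i : Fin 3 =>
      ContinuousLinearMap.proj (R := ℝ) (φ := fun _ : Fin 4 => ℝ) i.succ).hasFDerivAt
  have h : HasFDerivAt (fun q => f (pr q)) _ p := hf.hasFDerivAt.comp p hL
  rw [h.fderiv]
  rfl

theorem pd_comp_pr_zero (hf : DifferentiableAt ℝ f (pr p)) : pd 0 (fun q => f (pr q)) p = 0 := by
  have : pr (Pi.single 0 1) = 0 := by
    ext i
    simp [pr]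
  rw [pd, fderiv_comp_pr hf, this, map_zero]

theorem pd_comp_pr_succ (hf : DifferentiableAt ℝ f (pr p)) (i : Fin 3) :
    pd i.succ (fun q => f (pr q)) p = pd i f (pr p) := by
  have : pr (Pi.single i.succ 1) = Pi.single i 1 := by
    ext j
    simp [pr, Pi.single_apply]
  rw [pd, fderiv_comp_pr hf, this, pd]

theorem pd_comp_pr (hf : DifferentiableAt ℝ f (pr p)) (i : Fin 4) :
    pd i (fun q => f (pr q)) p
      = dx i * pd 0 f (pr p) + dy i * pd 1 f (pr p) + dz i * pd 2 f (pr p) := by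
  refine Fin.cases ?_ (fun j => ?_) i
  · simp [pd_comp_pr_zero hf, dx, dy, dz]
  · rw [pd_comp_pr_succ hf]
    fin_cases j <;> simp [dx, dy, dz, Fin.ext_iff]

end Total

section Algebra

variable (u w : (Fin 3 → ℝ) → ℝ) (θ : (Fin 4 → ℝ) → Fin 4 → ℝ) (p : Fin 4 → ℝ)

/-- The matrix of the coframe `(θ, dx, dy, dz)`. -/
def coframe : Matrix (Fin 4) (Fin 4) ℝ := Matrix.of ![θ p, dx, dy, dz]

/-- The metric in the coframe. -/
noncomputable def frameMetric (w h : ℝ) : Matrix (Fin 4) (Fin 4) ℝ :=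
  Matrix.diagonal ![w⁻¹, h, h, w]

/-- The fundamental form in the coframe. -/
def frameForm (h : ℝ) : Matrix (Fin 4) (Fin 4) ℝ :=
  !![0, 0, 0, 1; 0, 0, h, 0; 0, -h, 0, 0; -1, 0, 0, 0]

/-- The almost complex structure in the frame: `J E₀ = w⁻¹ E₃`, `J E₁ = E₂`. -/
noncomputable def frameJ (w : ℝ) : Matrix (Fin 4) (Fin 4) ℝ :=
  !![0, 0, 0, -w; 0, 0, -1, 0; 0, 1, 0, 0; w⁻¹, 0, 0, 0]

theorem det_coframe : (coframe θ p).det = θ p 0 := by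
  have h : (coframe θ p).BlockTriangular id := fun i j hij => by
    fin_cases i <;> fin_cases j <;>
      first | exact absurd hij (by decide) | simp [coframe, dx, dy, dz]
  rw [Matrix.det_of_isUpperTriangular h]
  simp [Fin.prod_univ_four, coframe, dx, dy, dz]

theorem metric_eq_coframe : metric u w θ p
    = (coframe θ p)ᵀ * frameMetric (w (pr p)) (expw u w (pr p)) * coframe θ p := by
  ext i j
  simp [metric, coframe, frameMetric, Matrix.mul_apply, Fin.sum_univ_four, sqForm,
    Matrix.diagonal_apply]
  ring

theorem OmegaJ_eq_coframe : OmegaJ u w θ p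
    = (coframe θ p)ᵀ * frameForm (expw u w (pr p)) * coframe θ p := by
  ext i j
  simp [OmegaJ, coframe, frameForm, Matrix.mul_apply, Fin.sum_univ_four, wedge]
  ring

theorem frameMetric_mul_frameJ {w h : ℝ} (hw : w ≠ 0) :
    frameMetric w h * frameJ w = (frameForm h)ᵀ := by
  ext i j
  fin_cases i <;> fin_cases j <;> simp [frameMetric, frameJ, frameForm, Matrix.mul_apply,
    Fin.sum_univ_four, hw]

theorem frameJ_mul_self {w : ℝ} (hw : w ≠ 0) : frameJ w * frameJ w = -1 := by
  ext i j
  fin_cases i <;> fin_cases j <;> simp [frameJ, Matrix.mul_apply, Fin.sum_univ_four, hw]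

theorem frameJ_orthogonal {w : ℝ} (h : ℝ) (hw : w ≠ 0) :
    (frameJ w)ᵀ * frameMetric w h * frameJ w = frameMetric w h := by
  rw [Matrix.mul_assoc, frameMetric_mul_frameJ hw]
  ext i j
  fin_cases i <;> fin_cases j <;> simp [frameMetric, frameJ, frameForm, Matrix.mul_apply,
    Fin.sum_univ_four]

theorem det_frameMetric {w : ℝ} (h : ℝ) (hw : w ≠ 0) : (frameMetric w h).det = h ^ 2 := by
  simp [frameMetric, Fin.prod_univ_four]
  field_simp

variable {u w θ p}

theorem expw_pos (hw : 0 < w (pr p)) : 0 < expw u w (pr p) := mul_pos (Real.exp_pos _) hw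

theorem isUnit_det_coframe (hθ : θ p 0 ≠ 0) : IsUnit (coframe θ p).det := by
  rw [det_coframe]
  exact hθ.isUnit

theorem posDef_metric (hw : 0 < w (pr p)) (hθ : θ p 0 ≠ 0) : (metric u w θ p).PosDef := by
  have hG : (frameMetric (w (pr p)) (expw u w (pr p))).PosDef := by
    refine Matrix.PosDef.diagonal fun i => ?_
    have := expw_pos (u := u) hw
    fin_cases i <;> simp [hw, this]
  rw [metric_eq_coframe]
  have := hG.conjTranspose_mul_mul_same (B := coframe θ p)
    (Matrix.mulVec_injective_iff_isUnit.mpr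
      ((Matrix.isUnit_iff_isUnit_det _).mpr (isUnit_det_coframe hθ)))
  simpa [Matrix.conjTranspose_eq_transpose_of_trivial] using this

theorem coframe_mul_JJ (hw : 0 < w (pr p)) (hθ : θ p 0 ≠ 0) :
    coframe θ p * JJ u w θ p = frameJ (w (pr p)) * coframe θ p := by
  have hP := isUnit_det_coframe hθ
  have e : metric u w θ p * ((coframe θ p)⁻¹ * (frameJ (w (pr p)) * coframe θ p))
      = (OmegaJ u w θ p)ᵀ := by
    rw [metric_eq_coframe, OmegaJ_eq_coframe]
    simp only [Matrix.mul_assoc]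
    rw [← Matrix.mul_assoc (coframe θ p) (coframe θ p)⁻¹, Matrix.mul_nonsing_inv _ hP,
      Matrix.one_mul, ← Matrix.mul_assoc (frameMetric _ _), frameMetric_mul_frameJ hw.ne']
    simp [Matrix.mul_assoc]
  have hg : IsUnit (metric u w θ p).det := (posDef_metric hw hθ).det_pos.ne'.isUnit
  rw [JJ, endOfForm, ← e, ← Matrix.mul_assoc (metric u w θ p)⁻¹, Matrix.nonsing_inv_mul _ hg,
    Matrix.one_mul, ← Matrix.mul_assoc, Matrix.mul_nonsing_inv _ hP, Matrix.one_mul]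

theorem fundamentalForm_eq (hw : 0 < w (pr p)) (hθ : θ p 0 ≠ 0) :
    fundamentalForm (metric u w θ) (JJ u w θ) p = OmegaJ u w θ p := by
  have hg : IsUnit (metric u w θ p).det := (posDef_metric hw hθ).det_pos.ne'.isUnit
  have hs : (metric u w θ p)ᵀ = metric u w θ p := (posDef_metric hw hθ).isHermitian
  have : metric u w θ p * JJ u w θ p = (OmegaJ u w θ p)ᵀ := by
    rw [JJ, endOfForm, ← Matrix.mul_assoc, Matrix.mul_nonsing_inv _ hg, Matrix.one_mul]
  rw [fundamentalForm]
  nth_rewrite 1 [← hs]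
  rw [← Matrix.transpose_mul, this, Matrix.transpose_transpose]

end Algebra

section Structure

variable {V : Set (Fin 3 → ℝ)} {w u : (Fin 3 → ℝ) → ℝ} {θ : (Fin 4 → ℝ) → Fin 4 → ℝ}

theorem smooth_expw (hw : ContDiffOn ℝ ∞ w V) (hu : ContDiffOn ℝ ∞ u V) :
    ContDiffOn ℝ ∞ (expw u w) V := hu.exp.mul hw

theorem smooth_coframe (hθ : ∀ i, ContDiffOn ℝ ∞ (fun p => θ p i) (total V)) :
    EntrySmoothOn (coframe θ) (total V) := fun a i => by
  fin_cases a
  · exact hθ i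
  all_goals exact contDiffOn_const

theorem smooth_frameMetric (hw : ContDiffOn ℝ ∞ w V) (hu : ContDiffOn ℝ ∞ u V)
    (hwpos : ∀ q ∈ V, 0 < w q) :
    EntrySmoothOn (fun p => frameMetric (w (pr p)) (expw u w (pr p))) (total V) := fun a b => by
  have h1 := smooth_comp_pr hw
  have h2 := smooth_comp_pr (smooth_expw hw hu)
  have h3 := h1.inv fun p hp => (hwpos _ hp).ne'
  by_cases h : a = b
  · subst h
    simp only [frameMetric, Matrix.diagonal_apply_eq]
    fin_cases a
    · exact h3
    · exact h2
    · exact h2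
    · exact h1
  · simp only [frameMetric, Matrix.diagonal_apply_ne _ h]
    exact contDiffOn_const

theorem smooth_frameJ (hw : ContDiffOn ℝ ∞ w V) (hwpos : ∀ q ∈ V, 0 < w q) :
    EntrySmoothOn (fun p => frameJ (w (pr p))) (total V) := fun a b => by
  have h1 := smooth_comp_pr hw
  have h2 := h1.neg
  have h3 := h1.inv fun p hp => (hwpos _ hp).ne'
  fin_cases a <;> fin_cases b <;> first | exact contDiffOn_const | exact h2 | exact h3

theorem JJ_eq_conj {p : Fin 4 → ℝ} (hw : 0 < w (pr p)) (hθ : θ p 0 ≠ 0) :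
    JJ u w θ p = (coframe θ p)⁻¹ * (frameJ (w (pr p)) * coframe θ p) := by
  rw [← coframe_mul_JJ hw hθ, ← Matrix.mul_assoc,
    Matrix.nonsing_inv_mul _ (isUnit_det_coframe hθ), Matrix.one_mul]

theorem isAlmostHermitian (hw : ContDiffOn ℝ ∞ w V) (hu : ContDiffOn ℝ ∞ u V)
    (hwpos : ∀ q ∈ V, 0 < w q) (hθ : ∀ i, ContDiffOn ℝ ∞ (fun p => θ p i) (total V))
    (hθ0 : ∀ p ∈ total V, θ p 0 ≠ 0) :
    IsAlmostHermitianOn (total V) (metric u w θ) (JJ u w θ) where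
  smooth_metric := by
    have hP := smooth_coframe hθ
    exact ((hP.transpose.mul (smooth_frameMetric hw hu hwpos)).mul hP).congr
      fun q _ => metric_eq_coframe u w θ q
  posDef p hp := posDef_metric (hwpos _ hp) (hθ0 p hp)
  smooth_J := by
    have hP := smooth_coframe hθ
    exact ((hP.inv fun p hp => isUnit_det_coframe (hθ0 p hp)).mul
      ((smooth_frameJ hw hwpos).mul hP)).congr fun q hq => JJ_eq_conj (hwpos _ hq) (hθ0 q hq)
  J_sq p hp := by
    have e := coframe_mul_JJ (u := u) (hwpos _ hp) (hθ0 p hp)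
    have hP := isUnit_det_coframe (hθ0 p hp)
    have : coframe θ p * (JJ u w θ p * JJ u w θ p) = coframe θ p * -1 := by
      rw [← Matrix.mul_assoc, e, Matrix.mul_assoc, e, ← Matrix.mul_assoc,
        frameJ_mul_self (hwpos _ hp).ne']
      simp
    simpa [← Matrix.mul_assoc, Matrix.nonsing_inv_mul _ hP] using
      congrArg ((coframe θ p)⁻¹ * ·) this
  orthogonal p hp := by
    have e := coframe_mul_JJ (u := u) (hwpos _ hp) (hθ0 p hp)
    rw [metric_eq_coframe]
    calc _ = (coframe θ p * JJ u w θ p)ᵀ * frameMetric (w (pr p)) (expw u w (pr p))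
          * (coframe θ p * JJ u w θ p) := by
            simp only [Matrix.transpose_mul, Matrix.mul_assoc]
      _ = (coframe θ p)ᵀ * ((frameJ (w (pr p)))ᵀ * frameMetric (w (pr p)) (expw u w (pr p))
          * frameJ (w (pr p))) * coframe θ p := by
            rw [e]
            simp only [Matrix.transpose_mul, Matrix.mul_assoc]
      _ = _ := by rw [frameJ_orthogonal _ (hwpos _ hp).ne']

/-- The fundamental form satisfies `dΩ = 2 (e^u w)_z dz ∧ dx ∧ dy`. -/
theorem d₂_fundamentalForm (hV : IsOpen V) (hw : ContDiffOn ℝ ∞ w V) (hu : ContDiffOn ℝ ∞ u V)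
    (hwpos : ∀ q ∈ V, 0 < w q) (hθ : ∀ i, ContDiffOn ℝ ∞ (fun p => θ p i) (total V))
    (hθ0 : ∀ p ∈ total V, θ p 0 ≠ 0)
    (hdθ : ∀ p ∈ total V,
      d₁ θ p = pd 0 w (pr p) • wedge dy dz + pd 1 w (pr p) • wedge dz dx
        + pd 2 (expw u w) (pr p) • wedge dx dy) {p : Fin 4 → ℝ} (hp : p ∈ total V)
    (i j k : Fin 4) :
    d₂ (fundamentalForm (metric u w θ) (JJ u w θ)) p i j k
      = 2 * pd 2 (expw u w) (pr p) *
        (dz i * wedge dx dy j k + dz j * wedge dx dy k i + dz k * wedge dx dy i j) := by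
  have hM := isOpen_total hV
  have hh : DifferentiableAt ℝ (expw u w) (pr p) :=
    differentiableAt_of_smooth hV (smooth_expw hw hu) hp
  have hh' := differentiableAt_of_smooth hM (smooth_comp_pr (smooth_expw hw hu)) hp
  have hθ' := fun i => differentiableAt_of_smooth hM (hθ i) hp
  have hD : ∀ i j, pd i (fun q => θ q j) p - pd j (fun q => θ q i) p
      = pd 0 w (pr p) * wedge dy dz i j + pd 1 w (pr p) * wedge dz dx i j
        + pd 2 (expw u w) (pr p) * wedge dx dy i j := fun i j => by
    simpa [d₁] using congrFun (congrFun (hdθ p hp) i) j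
  have e : ∀ i j k, pd i (fun q => fundamentalForm (metric u w θ) (JJ u w θ) q j k) p
      = dz k * pd i (fun q => θ q j) p - dz j * pd i (fun q => θ q k) p
        + (dx i * pd 0 (expw u w) (pr p) + dy i * pd 1 (expw u w) (pr p)
          + dz i * pd 2 (expw u w) (pr p)) * wedge dx dy j k := fun i j k => by
    rw [pd_congr_on (g := fun q => (dz k * θ q j - dz j * θ q k)
        + expw u w (pr q) * wedge dx dy j k) hM _ hp, pd_add, pd_sub, pd_mul, pd_mul, pd_mul,
        pd_const, pd_const, pd_const, pd_comp_pr hh]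
    · ring
    any_goals fun_prop
    · intro q hq
      rw [fundamentalForm_eq (hwpos _ hq) (hθ0 q hq)]
      simp [OmegaJ, wedge]
  rw [d₂, e, e, e]
  simp only [wedge, Matrix.of_apply] at hD ⊢
  linear_combination dz k * hD i j + dz i * hD j k + dz j * hD k i

end Structure

/-! ### Closedness of the fundamental form and integrability of `J` -/

/-- The matrix of `J` in the coordinates `(t, x, y, z)`, where `θ = a dt + b dx + c dy + d dz`. -/
noncomputable def coordJ (w a b c d : ℝ) : Matrix (Fin 4) (Fin 4) ℝ :=
  !![-(d / w), -(c / a) - b * d / (w * a), b / a - c * d / (w * a), -(w / a) - d * d / (w * a);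
    0, 0, -1, 0; 0, 1, 0, 0; a / w, b / w, c / w, d / w]

section Integrability

variable {V : Set (Fin 3 → ℝ)} {w u : (Fin 3 → ℝ) → ℝ} {θ : (Fin 4 → ℝ) → Fin 4 → ℝ}
  {p : Fin 4 → ℝ}

theorem JJ_eq_coordJ (hw : 0 < w (pr p)) (hθ : θ p 0 ≠ 0) :
    JJ u w θ p = coordJ (w (pr p)) (θ p 0) (θ p 1) (θ p 2) (θ p 3) := by
  have e : frameJ (w (pr p)) * coframe θ p
      = coframe θ p * coordJ (w (pr p)) (θ p 0) (θ p 1) (θ p 2) (θ p 3) := by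
    have := hw.ne'
    ext i j
    fin_cases i <;> fin_cases j <;>
      simp [coframe, frameJ, coordJ, Matrix.mul_apply, Fin.sum_univ_four, dx, dy, dz] <;>
      field_simp <;> ring
  rw [JJ_eq_conj hw hθ, e, ← Matrix.mul_assoc,
    Matrix.nonsing_inv_mul _ (isUnit_det_coframe hθ), Matrix.one_mul]

/-- The derivative of `coordJ` in terms of the derivatives `w', a', b', c', d'` of its
arguments. -/
noncomputable def coordJ' (w a b c d w' a' b' c' d' : ℝ) : Matrix (Fin 4) (Fin 4) ℝ :=
  !![-(d' / w) + d * w' / w ^ 2,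
    -(c' / a) + c * a' / a ^ 2 - (b' * d + b * d') / (w * a)
      + b * d * (w' * a + w * a') / (w * a) ^ 2,
    b' / a - b * a' / a ^ 2 - (c' * d + c * d') / (w * a)
      + c * d * (w' * a + w * a') / (w * a) ^ 2,
    -(w' / a) + w * a' / a ^ 2 - 2 * d * d' / (w * a) + d * d * (w' * a + w * a') / (w * a) ^ 2;
    0, 0, 0, 0; 0, 0, 0, 0;
    a' / w - a * w' / w ^ 2, b' / w - b * w' / w ^ 2, c' / w - c * w' / w ^ 2,
    d' / w - d * w' / w ^ 2]

theorem pd_coordJ {W a b c d : (Fin 4 → ℝ) → ℝ} (hW : DifferentiableAt ℝ W p)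
    (ha : DifferentiableAt ℝ a p) (hb : DifferentiableAt ℝ b p) (hc : DifferentiableAt ℝ c p)
    (hd : DifferentiableAt ℝ d p) (hW0 : W p ≠ 0) (ha0 : a p ≠ 0) (l k j : Fin 4) :
    pd l (fun q => coordJ (W q) (a q) (b q) (c q) (d q) k j) p
      = coordJ' (W p) (a p) (b p) (c p) (d p) (pd l W p) (pd l a p) (pd l b p) (pd l c p)
        (pd l d p) k j := by
  have h0 : W p * a p ≠ 0 := mul_ne_zero hW0 ha0
  fin_cases k <;> fin_cases j <;> simp [coordJ, coordJ']
  all_goals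
    simp (disch := first | assumption | fun_prop (disch := assumption)) only [pd_neg, pd_sub,
      pd_div, pd_mul]
    field_simp
    try ring

/-- The Nijenhuis tensor of `J` as an explicit expression in the first derivatives of `w` and
`θ`. -/
theorem nijenhuis_JJ (hV : IsOpen V) (hw : ContDiffOn ℝ ∞ w V)
    (hwpos : ∀ q ∈ V, 0 < w q) (hθ : ∀ i, ContDiffOn ℝ ∞ (fun p => θ p i) (total V))
    (hθ0 : ∀ p ∈ total V, θ p 0 ≠ 0) (hp : p ∈ total V) (k i j : Fin 4) :
    nijenhuis (JJ u w θ) k i j p =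
      let J := coordJ (w (pr p)) (θ p 0) (θ p 1) (θ p 2) (θ p 3)
      let J' : Fin 4 → Matrix (Fin 4) (Fin 4) ℝ := fun l =>
        coordJ' (w (pr p)) (θ p 0) (θ p 1) (θ p 2) (θ p 3)
          (dx l * pd 0 w (pr p) + dy l * pd 1 w (pr p) + dz l * pd 2 w (pr p))
          (pd l (fun q => θ q 0) p) (pd l (fun q => θ q 1) p) (pd l (fun q => θ q 2) p)
          (pd l (fun q => θ q 3) p)
      ∑ l, (J l i * J' l k j - J l j * J' l k i - J k l * (J' i l j - J' j l i)) := by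
  have hM := isOpen_total hV
  have hθ' := fun i => differentiableAt_of_smooth hM (hθ i) hp
  have e : ∀ l k j, pd l (fun q => JJ u w θ q k j) p = _ := fun l k j =>
    (pd_congr_on hM (fun q hq => by rw [JJ_eq_coordJ (hwpos _ hq) (hθ0 q hq)]) hp l).trans
      (pd_coordJ (differentiableAt_of_smooth hM (smooth_comp_pr hw) hp) (hθ' 0) (hθ' 1) (hθ' 2)
        (hθ' 3) (hwpos _ hp).ne' (hθ0 p hp) l k j)
  simp only [nijenhuis, e, JJ_eq_coordJ (hwpos _ hp) (hθ0 p hp),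
    pd_comp_pr (differentiableAt_of_smooth hV hw hp)]

set_option maxHeartbeats 4000000 in
/-- The Nijenhuis tensor vanishes where `w_x = w_y = (e^u w)_z = 0`, and its components
`N(∂ₜ, ∂ₓ)` and `N(∂ₜ, ∂_y)` along `∂_z` recover `w_y` and `w_x`. -/
theorem nijenhuis_JJ_values (hV : IsOpen V) (hw : ContDiffOn ℝ ∞ w V)
    (hwpos : ∀ q ∈ V, 0 < w q) (hθ : ∀ i, ContDiffOn ℝ ∞ (fun p => θ p i) (total V))
    (hθ0 : ∀ p ∈ total V, θ p 0 ≠ 0)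
    (hdθ : ∀ p ∈ total V,
      d₁ θ p = pd 0 w (pr p) • wedge dy dz + pd 1 w (pr p) • wedge dz dx
        + pd 2 (expw u w) (pr p) • wedge dx dy) (hp : p ∈ total V) :
    (pd 0 w (pr p) = 0 → pd 1 w (pr p) = 0 → pd 2 (expw u w) (pr p) = 0 →
      ∀ i j k, nijenhuis (JJ u w θ) k i j p = 0) ∧
    (nijenhuis (JJ u w θ) 3 0 1 p = 2 * θ p 0 * pd 1 w (pr p) / w (pr p) ^ 2) ∧
    (nijenhuis (JJ u w θ) 3 0 2 p = -(2 * θ p 0 * pd 0 w (pr p) / w (pr p) ^ 2)) := by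
  have hD : ∀ i j, pd i (fun q => θ q j) p - pd j (fun q => θ q i) p
      = pd 0 w (pr p) * wedge dy dz i j + pd 1 w (pr p) * wedge dz dx i j
        + pd 2 (expw u w) (pr p) * wedge dx dy i j := fun i j => by
    simpa [d₁] using congrFun (congrFun (hdθ p hp) i) j
  have ha : θ p 0 ≠ 0 := hθ0 p hp
  have hw0 : w (pr p) ≠ 0 := (hwpos _ hp).ne'
  have h10 := hD 1 0
  have h20 := hD 2 0
  have h30 := hD 3 0
  have h21 := hD 2 1
  have h31 := hD 3 1
  have h32 := hD 3 2
  simp [wedge, dx, dy, dz, sub_eq_iff_eq_add] at h10 h20 h30 h21 h31 h32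
  simp only [nijenhuis_JJ hV hw hwpos hθ hθ0 hp]
  refine ⟨fun h0 h1 h2 => ?_, ?_, ?_⟩
  · simp only [h0, h1, h2, neg_zero, zero_add] at h10 h20 h30 h21 h31 h32 ⊢
    intro k i j
    fin_cases k <;> fin_cases i <;> fin_cases j <;>
      simp [Fin.sum_univ_four, coordJ, coordJ', dx, dy, dz, h10, h20, h30, h21, h31, h32]
    all_goals try field_simp
    all_goals ring
  · simp [Fin.sum_univ_four, coordJ, coordJ', dx, dy, dz, h10, h20, h30, h21, h31]
    field_simp
    ring
  · simp [Fin.sum_univ_four, coordJ, coordJ', dx, dy, dz, h10, h20, h30, h21, h32]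
    field_simp
    ring

end Integrability

/-! ### The curvature of LeBrun's metric in the frame -/

/-- A skew-symmetric `4 × 4` matrix given by its entries above the diagonal. -/
def skew (a b c d e f : ℝ) : Matrix (Fin 4) (Fin 4) ℝ :=
  !![0, a, b, c; -a, 0, d, e; -b, -d, 0, f; -c, -e, -f, 0]

theorem skew_swap (a b c d e f : ℝ) (i j : Fin 4) :
    skew a b c d e f j i = -skew a b c d e f i j := by
  fin_cases i <;> fin_cases j <;> simp [skew]

theorem forall_fin_four {P : Fin 4 → Prop} (h0 : P 0) (h1 : P 1) (h2 : P 2) (h3 : P 3)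
    (i : Fin 4) : P i := by
  fin_cases i <;> assumption

/-- The matrices of `∇_{Eₐ}` in the frame, when `h = e^u w` satisfies `h_z = 0`; the arguments are
the values of `w`, `h` and their first derivatives. -/
noncomputable def frameConn (w wx wy wz h hx hy : ℝ) : Fin 4 → Matrix (Fin 4) (Fin 4) ℝ :=
  ![!![0, -(wx / (2 * w)), -(wy / (2 * w)), -(wz / (2 * w));
      wx / (2 * h * w ^ 2), 0, 0, wy / (2 * h * w);
      wy / (2 * h * w ^ 2), 0, 0, -(wx / (2 * h * w));
      wz / (2 * w ^ 3), -(wy / (2 * w ^ 2)), wx / (2 * w ^ 2), 0],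
    !![-(wx / (2 * w)), 0, 0, wy / 2;
      0, hx / (2 * h), hy / (2 * h), 0;
      0, -(hy / (2 * h)), hx / (2 * h), 0;
      -(wy / (2 * w ^ 2)), 0, 0, wx / (2 * w)],
    !![-(wy / (2 * w)), 0, 0, -(wx / 2);
      0, hy / (2 * h), -(hx / (2 * h)), 0;
      0, hx / (2 * h), hy / (2 * h), 0;
      wx / (2 * w ^ 2), 0, 0, wy / (2 * w)],
    !![-(wz / (2 * w)), -(wy / 2), wx / 2, 0;
      wy / (2 * h * w), 0, 0, -(wx / (2 * h));
      -(wx / (2 * h * w)), 0, 0, -(wy / (2 * h));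
      0, wx / (2 * w), wy / (2 * w), wz / (2 * w)]]

/-- The derivative of `frameConn` in terms of the derivatives (marked with a prime) of its
arguments. -/
noncomputable def frameConn' (w wx wy wz h hx hy w' wx' wy' wz' h' hx' hy' : ℝ) :
    Fin 4 → Matrix (Fin 4) (Fin 4) ℝ :=
  ![!![0, w' * wx / (2 * w ^ 2) + -(wx' / (2 * w)), w' * wy / (2 * w ^ 2) + -(wy' / (2 * w)),
        w' * wz / (2 * w ^ 2) + -(wz' / (2 * w));
      -(h' * wx / (2 * h ^ 2 * w ^ 2)) + -(w' * wx / (h * w ^ 3)) + wx' / (2 * h * w ^ 2), 0, 0,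
        -(h' * wy / (2 * h ^ 2 * w)) + -(w' * wy / (2 * h * w ^ 2)) + wy' / (2 * h * w);
      -(h' * wy / (2 * h ^ 2 * w ^ 2)) + -(w' * wy / (h * w ^ 3)) + wy' / (2 * h * w ^ 2), 0, 0,
        h' * wx / (2 * h ^ 2 * w) + w' * wx / (2 * h * w ^ 2) + -(wx' / (2 * h * w));
      -(3 * w' * wz / (2 * w ^ 4)) + wz' / (2 * w ^ 3), w' * wy / w ^ 3 + -(wy' / (2 * w ^ 2)),
        -(w' * wx / w ^ 3) + wx' / (2 * w ^ 2), 0],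
    !![w' * wx / (2 * w ^ 2) + -(wx' / (2 * w)), 0, 0, wy' / 2;
      0, -(h' * hx / (2 * h ^ 2)) + hx' / (2 * h), -(h' * hy / (2 * h ^ 2)) + hy' / (2 * h), 0;
      0, h' * hy / (2 * h ^ 2) + -(hy' / (2 * h)), -(h' * hx / (2 * h ^ 2)) + hx' / (2 * h), 0;
      w' * wy / w ^ 3 + -(wy' / (2 * w ^ 2)), 0, 0, -(w' * wx / (2 * w ^ 2)) + wx' / (2 * w)],
    !![w' * wy / (2 * w ^ 2) + -(wy' / (2 * w)), 0, 0, -(wx' / 2);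
      0, -(h' * hy / (2 * h ^ 2)) + hy' / (2 * h), h' * hx / (2 * h ^ 2) + -(hx' / (2 * h)), 0;
      0, -(h' * hx / (2 * h ^ 2)) + hx' / (2 * h), -(h' * hy / (2 * h ^ 2)) + hy' / (2 * h), 0;
      -(w' * wx / w ^ 3) + wx' / (2 * w ^ 2), 0, 0, -(w' * wy / (2 * w ^ 2)) + wy' / (2 * w)],
    !![w' * wz / (2 * w ^ 2) + -(wz' / (2 * w)), -(wy' / 2), wx' / 2, 0;
      -(h' * wy / (2 * h ^ 2 * w)) + -(w' * wy / (2 * h * w ^ 2)) + wy' / (2 * h * w), 0, 0,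
        h' * wx / (2 * h ^ 2) + -(wx' / (2 * h));
      h' * wx / (2 * h ^ 2 * w) + w' * wx / (2 * h * w ^ 2) + -(wx' / (2 * h * w)), 0, 0,
        h' * wy / (2 * h ^ 2) + -(wy' / (2 * h));
      0, -(w' * wx / (2 * w ^ 2)) + wx' / (2 * w), -(w' * wy / (2 * w ^ 2)) + wy' / (2 * w),
        -(w' * wz / (2 * w ^ 2)) + wz' / (2 * w)]]

/-- The structure equations `deᶜ = ∑ (T c a b) eᵃ ⊗ eᵇ` of the coframe when `h_z = 0`: only
`e⁰ = θ` is not closed. -/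
def frameTorsion (wx wy : ℝ) (c : Fin 4) : Matrix (Fin 4) (Fin 4) ℝ :=
  if c = 0 then skew 0 0 0 0 (-wy) wx else 0

theorem frameTorsion_swap (wx wy : ℝ) (c a b : Fin 4) :
    frameTorsion wx wy c b a = -frameTorsion wx wy c a b := by
  rw [frameTorsion]
  split_ifs
  · exact skew_swap _ _ _ _ _ _ a b
  · simp

section Jets

variable {n : ℕ} {w wx wy wz h hx hy : (Fin n → ℝ) → ℝ} {q : Fin n → ℝ}

set_option maxHeartbeats 2000000 in
theorem pd_frameConn (dw : DifferentiableAt ℝ w q) (dwx : DifferentiableAt ℝ wx q)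
    (dwy : DifferentiableAt ℝ wy q) (dwz : DifferentiableAt ℝ wz q)
    (dh : DifferentiableAt ℝ h q) (dhx : DifferentiableAt ℝ hx q)
    (dhy : DifferentiableAt ℝ hy q) (w0 : w q ≠ 0) (h0 : h q ≠ 0) (i : Fin n)
    (a b c : Fin 4) :
    pd i (fun q => frameConn (w q) (wx q) (wy q) (wz q) (h q) (hx q) (hy q) a b c) q
      = frameConn' (w q) (wx q) (wy q) (wz q) (h q) (hx q) (hy q) (pd i w q) (pd i wx q)
        (pd i wy q) (pd i wz q) (pd i h q) (pd i hx q) (pd i hy q) a b c := by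
  have h2 : (2 : ℝ) ≠ 0 := two_ne_zero
  have e2 : 2 * w q ≠ 0 := mul_ne_zero h2 w0
  have e3 : 2 * w q ^ 2 ≠ 0 := mul_ne_zero h2 (pow_ne_zero _ w0)
  have e4 : 2 * w q ^ 3 ≠ 0 := mul_ne_zero h2 (pow_ne_zero _ w0)
  have e5 : 2 * h q ≠ 0 := mul_ne_zero h2 h0
  have e6 : 2 * h q * w q ≠ 0 := mul_ne_zero e5 w0
  have e7 : 2 * h q * w q ^ 2 ≠ 0 := mul_ne_zero e5 (pow_ne_zero _ w0)
  fin_cases a <;> fin_cases b <;> fin_cases c <;> simp [frameConn, frameConn']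
  all_goals
    simp (disch := first | assumption | fun_prop (disch := assumption)) only [pd_neg, pd_div,
      pd_mul, pd_pow, pd_const]
    field_simp
    try ring

end Jets

/-- The curvature components `R(Eₐ, E_b, E_c, E_d)` of LeBrun's metric with `h_z = 0` in terms of
`w`, `A = R₀₁₀₁`, `A' = R₀₂₀₂`, `B = R₀₁₀₂`, `C = R₀₁₀₃`, `C' = R₀₂₀₃`, `D = R₀₃₀₃` and
`H = R₁₂₁₂`. -/
def curvTable (w A A' B C C' D H : ℝ) : Fin 4 → Fin 4 → Matrix (Fin 4) (Fin 4) ℝ :=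
  let R01 := skew A B C 0 (-(w * B)) (w * A)
  let R02 := skew B A' C' 0 (-(w * A')) (w * B)
  let R03 := skew C C' D (-(w * (A + A'))) (-(w * C')) (w * C)
  let R12 := skew 0 0 (-(w * (A + A'))) H 0 0
  let R13 := skew (-(w * B)) (-(w * A')) (-(w * C')) 0 (w ^ 2 * A') (-(w ^ 2 * B))
  let R23 := skew (w * A) (w * B) (w * C) 0 (-(w ^ 2 * B)) (w ^ 2 * A)
  ![![0, R01, R02, R03], ![-R01, 0, R12, R13], ![-R02, -R12, 0, R23], ![-R03, -R13, -R23, 0]]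

section Table

variable (w wx wy wz wxx wxy wxz wyz wzz h hx hy hxx hxy hyy : ℝ)

/-- The derivative of the connection matrices along `Eₐ`, from the second-order jets of `w` and `h`
with `h_z = 0` and `w_xx + w_yy = 0`. -/
noncomputable def jetConn' : Fin 4 → Fin 4 → Matrix (Fin 4) (Fin 4) ℝ :=
  ![fun _ => 0,
    frameConn' w wx wy wz h hx hy wx wxx wxy wxz hx hxx hxy,
    frameConn' w wx wy wz h hx hy wy wxy (-wxx) wyz hy hxy hyy,
    frameConn' w wx wy wz h hx hy wz wxz wyz wzz 0 0 0]

/-- The component `R₀₁₀₁`; interchanging `x` and `y` gives `R₀₂₀₂`. -/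
noncomputable def cA : ℝ := (hx * wx - hy * wy) / (4 * h * w ^ 2)
  + (3 * wx ^ 2 - wy ^ 2) / (4 * w ^ 3) - wxx / (2 * w ^ 2)

/-- The component `R₀₁₀₂`. -/
noncomputable def cB : ℝ := (hx * wy + hy * wx) / (4 * h * w ^ 2)
  + wx * wy / w ^ 3 - wxy / (2 * w ^ 2)

/-- The component `R₀₁₀₃` for `i = x`, and `R₀₂₀₃` for `i = y`. -/
noncomputable def cC (wi wiz : ℝ) : ℝ := wz * wi / w ^ 3 - wiz / (2 * w ^ 2)

/-- The component `R₀₃₀₃`. -/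
noncomputable def cD : ℝ := wz ^ 2 / w ^ 3 - wzz / (2 * w ^ 2) - (wx ^ 2 + wy ^ 2) / (2 * h * w ^ 2)

/-- The component `R₁₂₁₂`. -/
noncomputable def cH : ℝ := (hxx + hyy) / 2 - (hx ^ 2 + hy ^ 2) / (2 * h)

set_option maxHeartbeats 4000000 in
/-- The curvature components: all of them are determined by the seven functions in
`curvTable`. -/
theorem frameCurv_eq_curvTable (w0 : w ≠ 0) (h0 : h ≠ 0) (a b : Fin 4) :
    (frameCurv (frameConn w wx wy wz h hx hy) (frameTorsion wx wy)
        (jetConn' w wx wy wz wxx wxy wxz wyz wzz h hx hy hxx hxy hyy) a b)ᵀ * frameMetric w h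
      = curvTable w (cA w wx wy wxx h hx hy) (cA w wy wx (-wxx) h hy hx)
        (cB w wx wy wxy h hx hy) (cC w wz wx wxz) (cC w wz wy wyz) (cD w wx wy wz wzz h)
        (cH h hx hy hxx hyy) a b := by
  have key : ∀ a b, a < b →
      (frameCurv (frameConn w wx wy wz h hx hy) (frameTorsion wx wy)
        (jetConn' w wx wy wz wxx wxy wxz wyz wzz h hx hy hxx hxy hyy) a b)ᵀ * frameMetric w h
      = curvTable w (cA w wx wy wxx h hx hy) (cA w wy wx (-wxx) h hy hx)
        (cB w wx wy wxy h hx hy) (cC w wz wx wxz) (cC w wz wy wyz) (cD w wx wy wz wzz h)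
        (cH h hx hy hxx hyy) a b := by
    intro a b hab
    ext c d
    rw [frameMetric, Matrix.mul_diagonal, Matrix.transpose_apply]
    revert a b c d
    refine forall_fin_four ?_ ?_ ?_ ?_ <;> refine forall_fin_four ?_ ?_ ?_ ?_ <;> intro hab <;>
      first | exact absurd hab (by decide) | clear hab
    all_goals
      refine forall_fin_four ?_ ?_ ?_ ?_ <;> refine forall_fin_four ?_ ?_ ?_ ?_ <;>
        simp only [frameCurv, jetConn', frameConn, frameConn', frameTorsion, curvTable, skew,
          Fin.sum_univ_four, Matrix.add_apply, Matrix.sub_apply, Matrix.mul_apply, Matrix.cons_val,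
          Matrix.of_apply, Matrix.smul_apply, smul_eq_mul, Matrix.zero_apply, Fin.reduceEq, if_true,
          if_false, one_ne_zero, cA, cB, cC, cD, cH]
    all_goals try field_simp
    all_goals try ring
  rcases lt_trichotomy a b with hab | rfl | hab
  · exact key a b hab
  · rw [frameCurv_self (frameTorsion_swap wx wy), Matrix.transpose_zero, Matrix.zero_mul]
    fin_cases a <;> rfl
  · rw [frameCurv_swap (frameTorsion_swap wx wy), Matrix.transpose_neg, Matrix.neg_mul, key b a hab]
    fin_cases a <;> fin_cases b <;> first | exact absurd hab (by decide) | simp [curvTable]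

end Table

/-! ### The Gray conditions in the frame -/

section GrayAlgebra

variable (w A A' B C C' D H : ℝ)

/-- The curvature 4-linear form with the components `curvTable`. -/
def curvForm (x y z v : Fin 4 → ℝ) : ℝ :=
  ∑ a, ∑ b, ∑ c, ∑ d, curvTable w A A' B C C' D H a b c d * x a * y b * z c * v d

/-- The value of the curvature form in terms of the bivectors `x ∧ y` and `z ∧ v`. -/
theorem curvForm_eq (x y z v : Fin 4 → ℝ) : curvForm w A A' B C C' D H x y z v =
    let p := fun a b => x a * y b - x b * y a
    let q := fun a b => z a * v b - z b * v a
    let E := -(w * (A + A'))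
    p 0 1 * (A * q 0 1 + B * q 0 2 + C * q 0 3 - w * B * q 1 3 + w * A * q 2 3)
    + p 0 2 * (B * q 0 1 + A' * q 0 2 + C' * q 0 3 - w * A' * q 1 3 + w * B * q 2 3)
    + p 0 3 * (C * q 0 1 + C' * q 0 2 + D * q 0 3 + E * q 1 2 - w * C' * q 1 3 + w * C * q 2 3)
    + p 1 2 * (E * q 0 3 + H * q 1 2)
    + p 1 3 * (-w * B * q 0 1 - w * A' * q 0 2 - w * C' * q 0 3 + w ^ 2 * A' * q 1 3
      - w ^ 2 * B * q 2 3)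
    + p 2 3 * (w * A * q 0 1 + w * B * q 0 2 + w * C * q 0 3 - w ^ 2 * B * q 1 3
      + w ^ 2 * A * q 2 3) := by
  simp only [curvForm, curvTable, skew, Fin.sum_univ_four, Matrix.cons_val, Matrix.of_apply,
    Matrix.neg_apply, Matrix.zero_apply]
  ring

theorem frameJ_mulVec (x : Fin 4 → ℝ) : frameJ w *ᵥ x = ![-w * x 3, -x 2, x 1, w⁻¹ * x 0] := by
  ext i
  fin_cases i <;> simp [frameJ, Matrix.mulVec, dotProduct, Fin.sum_univ_four]

variable {w A A' B C C' D H}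

theorem curvForm_gray₃_iff (hw : w ≠ 0) :
    (∀ x y z v, curvForm w A A' B C C' D H x y z v
      = curvForm w A A' B C C' D H (frameJ w *ᵥ x) (frameJ w *ᵥ y) (frameJ w *ᵥ z)
        (frameJ w *ᵥ v)) ↔ C = 0 ∧ C' = 0 := by
  simp only [curvForm_eq, frameJ_mulVec, Matrix.cons_val]
  constructor
  · intro h
    have h1 := h ![1, 0, 0, 0] ![0, 1, 0, 0] ![1, 0, 0, 0] ![0, 0, 0, 1]
    have h2 := h ![1, 0, 0, 0] ![0, 0, 1, 0] ![1, 0, 0, 0] ![0, 0, 0, 1]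
    simp only [Matrix.cons_val] at h1 h2
    field_simp at h1 h2
    constructor <;> linarith
  · rintro ⟨rfl, rfl⟩ x y z v
    field_simp
    ring

theorem curvForm_gray₂_iff (hw : w ≠ 0) :
    (∀ x y z v, curvForm w A A' B C C' D H x y z v
        - curvForm w A A' B C C' D H (frameJ w *ᵥ x) (frameJ w *ᵥ y) z v
      = curvForm w A A' B C C' D H (frameJ w *ᵥ x) y (frameJ w *ᵥ z) v
        + curvForm w A A' B C C' D H (frameJ w *ᵥ x) y z (frameJ w *ᵥ v)) ↔
      (C = 0 ∧ C' = 0) ∧ A = A' ∧ B = 0 := by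
  simp only [curvForm_eq, frameJ_mulVec, Matrix.cons_val]
  constructor
  · intro h
    have h1 := h ![0, 1, 0, 0] ![0, 0, 0, 1] ![1, 0, 0, 0] ![0, 0, 0, 1]
    have h2 := h ![0, 0, 1, 0] ![0, 0, 0, 1] ![1, 0, 0, 0] ![0, 0, 0, 1]
    have h3 := h ![1, 0, 0, 0] ![0, 1, 0, 0] ![1, 0, 0, 0] ![0, 1, 0, 0]
    have h4 := h ![1, 0, 0, 0] ![0, 1, 0, 0] ![1, 0, 0, 0] ![0, 0, 1, 0]
    simp only [Matrix.cons_val] at h1 h2 h3 h4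
    field_simp at h1 h2 h3 h4
    ring_nf at h1 h2 h3 h4
    have w2 := pow_ne_zero 2 hw
    have w3 := pow_ne_zero 3 hw
    refine ⟨⟨mul_left_cancel₀ w3 ?_, mul_left_cancel₀ w3 ?_⟩, mul_left_cancel₀ w2 ?_,
      mul_left_cancel₀ w2 ?_⟩ <;> linarith
  · rintro ⟨⟨rfl, rfl⟩, rfl, rfl⟩ x y z v
    field_simp
    ring

end GrayAlgebra

section LeviCivita

theorem contDiffOn_frameConn {n : ℕ} {w wx wy wz h hx hy : (Fin n → ℝ) → ℝ}
    {M : Set (Fin n → ℝ)} (sw : ContDiffOn ℝ ∞ w M) (swx : ContDiffOn ℝ ∞ wx M)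
    (swy : ContDiffOn ℝ ∞ wy M) (swz : ContDiffOn ℝ ∞ wz M) (sh : ContDiffOn ℝ ∞ h M)
    (shx : ContDiffOn ℝ ∞ hx M) (shy : ContDiffOn ℝ ∞ hy M) (w0 : ∀ q ∈ M, w q ≠ 0)
    (h0 : ∀ q ∈ M, h q ≠ 0) (a b c : Fin 4) :
    ContDiffOn ℝ ∞
      (fun q => frameConn (w q) (wx q) (wy q) (wz q) (h q) (hx q) (hy q) a b c) M := by
  have h2 : (2 : ℝ) ≠ 0 := two_ne_zero
  have e1 : ∀ q ∈ M, (2 : ℝ) ≠ 0 := fun _ _ => h2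
  have e2 : ∀ q ∈ M, 2 * w q ≠ 0 := fun q hq => mul_ne_zero h2 (w0 q hq)
  have e3 : ∀ q ∈ M, 2 * w q ^ 2 ≠ 0 := fun q hq => mul_ne_zero h2 (pow_ne_zero _ (w0 q hq))
  have e4 : ∀ q ∈ M, 2 * w q ^ 3 ≠ 0 := fun q hq => mul_ne_zero h2 (pow_ne_zero _ (w0 q hq))
  have e5 : ∀ q ∈ M, 2 * h q ≠ 0 := fun q hq => mul_ne_zero h2 (h0 q hq)
  have e6 : ∀ q ∈ M, 2 * h q * w q ≠ 0 := fun q hq => mul_ne_zero (e5 q hq) (w0 q hq)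
  have e7 : ∀ q ∈ M, 2 * h q * w q ^ 2 ≠ 0 := fun q hq =>
    mul_ne_zero (e5 q hq) (pow_ne_zero _ (w0 q hq))
  fin_cases a <;> fin_cases b <;> fin_cases c <;> simp [frameConn]
  all_goals fun_prop (disch := assumption)

/-- The derivative of `frameMetric` in terms of the derivatives of its arguments. -/
noncomputable def frameMetric' (w w' h' : ℝ) : Matrix (Fin 4) (Fin 4) ℝ :=
  Matrix.diagonal ![-(w' / w ^ 2), h', h', w']

theorem frameTorsion_eq (w wx wy wz h hx hy : ℝ) (c a b : Fin 4) :
    frameTorsion wx wy c a b = frameConn w wx wy wz h hx hy b c a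
      - frameConn w wx wy wz h hx hy a c b := by
  revert c a b
  refine forall_fin_four ?_ ?_ ?_ ?_ <;> refine forall_fin_four ?_ ?_ ?_ ?_ <;>
    refine forall_fin_four ?_ ?_ ?_ ?_ <;>
    simp only [frameTorsion, frameConn, skew, Matrix.cons_val, Matrix.of_apply, Matrix.zero_apply,
      Fin.reduceEq, if_true, if_false, one_ne_zero] <;> ring

theorem frameMetric'_eq {w h : ℝ} (wx wy wz hx hy : ℝ) (w0 : w ≠ 0) (h0 : h ≠ 0) (a : Fin 4) :
    frameMetric' w (![0, wx, wy, wz] a) (![0, hx, hy, 0] a)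
      = (frameConn w wx wy wz h hx hy a)ᵀ * frameMetric w h
        + frameMetric w h * frameConn w wx wy wz h hx hy a := by
  ext b c
  rw [frameMetric, Matrix.add_apply, Matrix.mul_diagonal, Matrix.diagonal_mul,
    Matrix.transpose_apply, frameMetric', Matrix.diagonal_apply]
  revert a b c
  refine forall_fin_four ?_ ?_ ?_ ?_ <;> refine forall_fin_four ?_ ?_ ?_ ?_ <;>
    refine forall_fin_four ?_ ?_ ?_ ?_ <;>
    simp only [frameConn, Matrix.cons_val, Matrix.of_apply, Fin.reduceEq, if_true, if_false,
      one_ne_zero, zero_ne_one]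
  all_goals try field_simp
  all_goals try ring

variable {V : Set (Fin 3 → ℝ)} {w u : (Fin 3 → ℝ) → ℝ} {θ : (Fin 4 → ℝ) → Fin 4 → ℝ}

/-- The connection matrices of LeBrun's metric at a point of `ℝ³`. -/
noncomputable def lebrunConn (u w : (Fin 3 → ℝ) → ℝ) (a : Fin 4) (q : Fin 3 → ℝ) :
    Matrix (Fin 4) (Fin 4) ℝ :=
  frameConn (w q) (pd 0 w q) (pd 1 w q) (pd 2 w q) (expw u w q) (pd 0 (expw u w) q)
    (pd 1 (expw u w) q) a

/-- The derivatives of `lebrunConn` along the frame. -/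
noncomputable def lebrunConn' (u w : (Fin 3 → ℝ) → ℝ) (a b : Fin 4) (q : Fin 3 → ℝ) :
    Matrix (Fin 4) (Fin 4) ℝ :=
  jetConn' (w q) (pd 0 w q) (pd 1 w q) (pd 2 w q) (pd 0 (pd 0 w) q) (pd 0 (pd 1 w) q)
    (pd 0 (pd 2 w) q) (pd 1 (pd 2 w) q) (pd 2 (pd 2 w) q) (expw u w q) (pd 0 (expw u w) q)
    (pd 1 (expw u w) q) (pd 0 (pd 0 (expw u w)) q) (pd 0 (pd 1 (expw u w)) q)
    (pd 1 (pd 1 (expw u w)) q) a b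

theorem pd_eq_zero_of_eqOn (hV : IsOpen V) {f : (Fin 3 → ℝ) → ℝ} (hf : ∀ q ∈ V, f q = 0)
    {q : Fin 3 → ℝ} (hq : q ∈ V) (i : Fin 3) : pd i f q = 0 := by
  rw [pd_congr_on hV (g := fun _ => 0) hf hq, pd_const]

theorem harmonic_of_almostKahler (hV : IsOpen V)
    (heq : ∀ q ∈ V, pd 0 (pd 0 w) q + pd 1 (pd 1 w) q + pd 2 (pd 2 (expw u w)) q = 0)
    (hz : ∀ q ∈ V, pd 2 (expw u w) q = 0) {q : Fin 3 → ℝ} (hq : q ∈ V) :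
    pd 0 (pd 0 w) q + pd 1 (pd 1 w) q = 0 := by
  have := heq q hq
  rwa [pd_eq_zero_of_eqOn hV hz hq, add_zero] at this

theorem pd_lebrunConn (hV : IsOpen V) (hw : ContDiffOn ℝ ∞ w V) (hu : ContDiffOn ℝ ∞ u V)
    (hwpos : ∀ q ∈ V, 0 < w q)
    (heq : ∀ q ∈ V, pd 0 (pd 0 w) q + pd 1 (pd 1 w) q + pd 2 (pd 2 (expw u w)) q = 0)
    (hz : ∀ q ∈ V, pd 2 (expw u w) q = 0) {q : Fin 3 → ℝ} (hq : q ∈ V) (i : Fin 3)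
    (a b c : Fin 4) :
    pd i (fun q => lebrunConn u w a q b c) q = lebrunConn' u w i.succ a q b c := by
  have hh := smooth_expw hw hu
  have d := fun {f} (hf : ContDiffOn ℝ ∞ f V) => differentiableAt_of_smooth hV hf hq
  have hyy := harmonic_of_almostKahler hV heq hz hq
  have e := pd_frameConn (d hw) (d (contDiffOn_pd hV hw 0)) (d (contDiffOn_pd hV hw 1))
    (d (contDiffOn_pd hV hw 2)) (d hh) (d (contDiffOn_pd hV hh 0)) (d (contDiffOn_pd hV hh 1))
    (hwpos q hq).ne' (mul_pos (Real.exp_pos _) (hwpos q hq)).ne' i a b c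
  refine e.trans ?_
  have c1 := pd_comm hV hw hq 1 0
  have c2 := pd_comm hV hw hq 2 0
  have c3 := pd_comm hV hw hq 2 1
  have c4 := pd_comm hV hh hq 1 0
  have c5 := pd_comm hV hh hq 2 0
  have c6 := pd_comm hV hh hq 2 1
  rw [pd_eq_zero_of_eqOn hV hz hq] at c5 c6
  have c7 : pd 1 (pd 1 w) q = -pd 0 (pd 0 w) q := by linarith
  revert i
  simp only [Fin.forall_fin_succ, IsEmpty.forall_iff, and_true]
  refine ⟨fun _ => rfl, fun _ => ?_, fun _ => ?_⟩
  · change frameConn' _ _ _ _ _ _ _ _ (pd 1 (pd 0 w) q) (pd 1 (pd 1 w) q) _ _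
      (pd 1 (pd 0 (expw u w)) q) _ a b c = _
    rw [c1, c4, c7]
    rfl
  · change frameConn' _ _ _ _ _ _ _ _ (pd 2 (pd 0 w) q) (pd 2 (pd 1 w) q) _ (pd 2 (expw u w) q)
      (pd 2 (pd 0 (expw u w)) q) (pd 2 (pd 1 (expw u w)) q) a b c = _
    rw [c2, c3, c5, c6, hz q hq]
    rfl

theorem isLeviCivitaCoframe (hV : IsOpen V) (hw : ContDiffOn ℝ ∞ w V) (hu : ContDiffOn ℝ ∞ u V)
    (hwpos : ∀ q ∈ V, 0 < w q)
    (heq : ∀ q ∈ V, pd 0 (pd 0 w) q + pd 1 (pd 1 w) q + pd 2 (pd 2 (expw u w)) q = 0)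
    (hθ : ∀ i, ContDiffOn ℝ ∞ (fun p => θ p i) (total V))
    (hθ0 : ∀ p ∈ total V, θ p 0 ≠ 0)
    (hdθ : ∀ p ∈ total V,
      d₁ θ p = pd 0 w (pr p) • wedge dy dz + pd 1 w (pr p) • wedge dz dx
        + pd 2 (expw u w) (pr p) • wedge dx dy)
    (hz : ∀ q ∈ V, pd 2 (expw u w) q = 0) :
    IsLeviCivitaCoframe (total V) (metric u w θ) (coframe θ)
      (fun p => frameMetric (w (pr p)) (expw u w (pr p)))
      (fun a p => lebrunConn u w a (pr p))
      (fun c p => frameTorsion (pd 0 w (pr p)) (pd 1 w (pr p)) c)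
      (fun a p => frameMetric' (w (pr p)) (![0, pd 0 w (pr p), pd 1 w (pr p), pd 2 w (pr p)] a)
        (![0, pd 0 (expw u w) (pr p), pd 1 (expw u w) (pr p), 0] a))
      (fun a b p => lebrunConn' u w a b (pr p)) where
  isOpen := isOpen_total hV
  smooth_P := smooth_coframe hθ
  smooth_G := smooth_frameMetric hw hu hwpos
  smooth_Om a b c := by
    have hh := smooth_expw hw hu
    exact smooth_comp_pr (f := fun q => lebrunConn u w a q b c)
      (contDiffOn_frameConn hw (contDiffOn_pd hV hw 0) (contDiffOn_pd hV hw 1)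
        (contDiffOn_pd hV hw 2) hh (contDiffOn_pd hV hh 0) (contDiffOn_pd hV hh 1)
        (fun q hq => (hwpos q hq).ne')
        (fun q hq => (mul_pos (Real.exp_pos _) (hwpos q hq)).ne') a b c)
  det_P p hp := isUnit_det_coframe (hθ0 p hp)
  det_G p hp := by
    rw [det_frameMetric _ (hwpos _ hp).ne']
    exact (pow_ne_zero 2 (expw_pos (hwpos _ hp)).ne').isUnit
  symm_G p _ := Matrix.diagonal_transpose _
  metric_eq p _ := metric_eq_coframe u w θ p
  pd_P p hp i j c := by
    revert c
    have hc : ∀ v : ℝ, ∀ i : Fin 4, pd i (fun _ : Fin 4 → ℝ => v) p = 0 := fun v i => pd_const i v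
    refine forall_fin_four ?_ ?_ ?_ ?_
    · have := congrFun (congrFun (hdθ p hp) i) j
      rw [hz _ hp] at this
      refine this.trans ?_
      simp [wedge, frameTorsion, skew, coframe, Fin.sum_univ_four]
      ring
    all_goals simp [pdM, coframe, frameTorsion]
  pd_G p hp i := by
    have dw := differentiableAt_of_smooth hV hw hp
    have dh := differentiableAt_of_smooth hV (smooth_expw hw hu) hp
    have dw' := differentiableAt_of_smooth (isOpen_total hV) (smooth_comp_pr hw) hp
    ext b c
    rw [Matrix.sum_apply, pdM, Matrix.of_apply]
    by_cases hbc : b = c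
    · subst hbc
      simp only [frameMetric, frameMetric', Matrix.diagonal_apply_eq, Matrix.smul_apply,
        Fin.sum_univ_four, coframe, Matrix.of_apply]
      revert b
      refine forall_fin_four ?_ ?_ ?_ ?_ <;> simp only [Matrix.cons_val, smul_eq_mul]
      · rw [pd_inv i dw' (hwpos _ hp).ne', pd_comp_pr dw]
        ring
      · rw [pd_comp_pr dh, hz _ hp]
        ring
      · rw [pd_comp_pr dh, hz _ hp]
        ring
      · rw [pd_comp_pr dw]
        ring
    · simp [frameMetric, frameMetric', Matrix.diagonal_apply_ne _ hbc]
  pd_Om p hp i b := by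
    have hh := smooth_expw hw hu
    ext c d
    have hs : DifferentiableAt ℝ (fun q => lebrunConn u w b q c d) (pr p) :=
      differentiableAt_of_smooth hV
        (contDiffOn_frameConn hw (contDiffOn_pd hV hw 0) (contDiffOn_pd hV hw 1)
          (contDiffOn_pd hV hw 2) hh (contDiffOn_pd hV hh 0) (contDiffOn_pd hV hh 1)
          (fun q hq => (hwpos q hq).ne')
          (fun q hq => (mul_pos (Real.exp_pos _) (hwpos q hq)).ne') b c d) hp
    rw [pdM, Matrix.of_apply, pd_comp_pr hs]
    simp only [pd_lebrunConn hV hw hu hwpos heq hz hp, Fin.sum_univ_four, Matrix.add_apply,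
      Matrix.smul_apply, smul_eq_mul]
    have h0 : lebrunConn' u w 0 b (pr p) = 0 := rfl
    rw [h0, Matrix.zero_apply, mul_zero, zero_add]
    rfl
  torsion p _ c a b := frameTorsion_eq _ _ _ _ _ _ _ c a b
  parallel p hp a := frameMetric'_eq _ _ _ _ _ (hwpos _ hp).ne' (expw_pos (hwpos _ hp)).ne' a

end LeviCivita

/-! ### The Gray conditions as differential equations -/

section GrayEquations

variable {V : Set (Fin 3 → ℝ)} {w u : (Fin 3 → ℝ) → ℝ} {θ : (Fin 4 → ℝ) → Fin 4 → ℝ}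

theorem pr_cons (t : ℝ) (q : Fin 3 → ℝ) : pr (Fin.cons t q) = q := by
  ext i
  simp [pr]

theorem forall_total {Q : (Fin 3 → ℝ) → Prop} :
    (∀ p ∈ total V, Q (pr p)) ↔ ∀ q ∈ V, Q q :=
  ⟨fun h q hq => by
    have := h (Fin.cons 0 q) (by rwa [total, Set.mem_ofPred_eq, pr_cons])
    rwa [pr_cons] at this, fun h p hp => h _ hp⟩

/-- The curvature form of LeBrun's metric at a point of `ℝ³`, in the frame. -/
noncomputable def lebrunCurv (u w : (Fin 3 → ℝ) → ℝ) (q : Fin 3 → ℝ) :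
    (Fin 4 → ℝ) → (Fin 4 → ℝ) → (Fin 4 → ℝ) → (Fin 4 → ℝ) → ℝ :=
  let h := expw u w
  curvForm (w q) (cA (w q) (pd 0 w q) (pd 1 w q) (pd 0 (pd 0 w) q) (h q) (pd 0 h q) (pd 1 h q))
    (cA (w q) (pd 1 w q) (pd 0 w q) (-pd 0 (pd 0 w) q) (h q) (pd 1 h q) (pd 0 h q))
    (cB (w q) (pd 0 w q) (pd 1 w q) (pd 0 (pd 1 w) q) (h q) (pd 0 h q) (pd 1 h q))
    (cC (w q) (pd 2 w q) (pd 0 w q) (pd 0 (pd 2 w) q))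
    (cC (w q) (pd 2 w q) (pd 1 w q) (pd 1 (pd 2 w) q))
    (cD (w q) (pd 0 w q) (pd 1 w q) (pd 2 w q) (pd 2 (pd 2 w) q) (h q))
    (cH (h q) (pd 0 h q) (pd 1 h q) (pd 0 (pd 0 h) q) (pd 1 (pd 1 h) q))

theorem forall_mulVec {P : Matrix (Fin 4) (Fin 4) ℝ} (hP : IsUnit P.det)
    {Q : (Fin 4 → ℝ) → (Fin 4 → ℝ) → (Fin 4 → ℝ) → (Fin 4 → ℝ) → Prop} :
    (∀ X Y Z W, Q (P *ᵥ X) (P *ᵥ Y) (P *ᵥ Z) (P *ᵥ W)) ↔ ∀ x y z v, Q x y z v := by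
  refine ⟨fun h x y z v => ?_, fun h X Y Z W => h _ _ _ _⟩
  have := h (P⁻¹ *ᵥ x) (P⁻¹ *ᵥ y) (P⁻¹ *ᵥ z) (P⁻¹ *ᵥ v)
  simpa only [Matrix.mulVec_mulVec, Matrix.mul_nonsing_inv _ hP, Matrix.one_mulVec] using this

theorem coframe_mulVec_JJ {p : Fin 4 → ℝ} (hw : 0 < w (pr p)) (hθ : θ p 0 ≠ 0) (X : Fin 4 → ℝ) :
    coframe θ p *ᵥ (JJ u w θ p *ᵥ X) = frameJ (w (pr p)) *ᵥ (coframe θ p *ᵥ X) := by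
  rw [Matrix.mulVec_mulVec, coframe_mul_JJ hw hθ, Matrix.mulVec_mulVec]

/-- In the frame, the curvature of LeBrun's metric only depends on the projection to `ℝ³`. -/
theorem Rm_metric (hV : IsOpen V) (hw : ContDiffOn ℝ ∞ w V) (hu : ContDiffOn ℝ ∞ u V)
    (hwpos : ∀ q ∈ V, 0 < w q)
    (heq : ∀ q ∈ V, pd 0 (pd 0 w) q + pd 1 (pd 1 w) q + pd 2 (pd 2 (expw u w)) q = 0)
    (hθ : ∀ i, ContDiffOn ℝ ∞ (fun p => θ p i) (total V))
    (hθ0 : ∀ p ∈ total V, θ p 0 ≠ 0)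
    (hdθ : ∀ p ∈ total V,
      d₁ θ p = pd 0 w (pr p) • wedge dy dz + pd 1 w (pr p) • wedge dz dx
        + pd 2 (expw u w) (pr p) • wedge dx dy)
    (hz : ∀ q ∈ V, pd 2 (expw u w) q = 0) {p : Fin 4 → ℝ} (hp : p ∈ total V)
    (X Y Z W : Fin 4 → ℝ) :
    Rm (metric u w θ) p X Y Z W = lebrunCurv u w (pr p) (coframe θ p *ᵥ X) (coframe θ p *ᵥ Y)
      (coframe θ p *ᵥ Z) (coframe θ p *ᵥ W) := by
  rw [(isLeviCivitaCoframe hV hw hu hwpos heq hθ hθ0 hdθ hz).Rm_eq hp]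
  simp only [lebrunCurv, curvForm]
  refine Finset.sum_congr rfl fun a _ => Finset.sum_congr rfl fun b _ =>
    Finset.sum_congr rfl fun c _ => Finset.sum_congr rfl fun d _ => ?_
  rw [← frameCurv_eq_curvTable (hxy := pd 0 (pd 1 (expw u w)) (pr p)) (w0 := (hwpos _ hp).ne')
    (h0 := (expw_pos (u := u) (hwpos _ hp)).ne')]
  rfl

theorem cC_eq_zero_iff {w wz wi wiz : ℝ} (hw : w ≠ 0) :
    cC w wz wi wiz = 0 ↔ w * wiz = 2 * wz * wi := by
  rw [cC]
  field_simp
  constructor <;> intro h <;> linarith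

theorem pd_expw {q : Fin 3 → ℝ} (i : Fin 3) (dw : DifferentiableAt ℝ w q)
    (du : DifferentiableAt ℝ u q) :
    pd i (expw u w) q = Real.exp (u q) * (w q * pd i u q + pd i w q) := by
  have : expw u w = fun q => Real.exp (u q) * w q := rfl
  rw [this, pd_mul i du.exp dw, pd_exp i du]
  ring

/-- The third Gray condition says that the `x`- and `y`-derivatives of `w_z / w²` vanish. -/
theorem gray₃On_iff (hV : IsOpen V) (hw : ContDiffOn ℝ ∞ w V) (hu : ContDiffOn ℝ ∞ u V)
    (hwpos : ∀ q ∈ V, 0 < w q)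
    (heq : ∀ q ∈ V, pd 0 (pd 0 w) q + pd 1 (pd 1 w) q + pd 2 (pd 2 (expw u w)) q = 0)
    (hθ : ∀ i, ContDiffOn ℝ ∞ (fun p => θ p i) (total V))
    (hθ0 : ∀ p ∈ total V, θ p 0 ≠ 0)
    (hdθ : ∀ p ∈ total V,
      d₁ θ p = pd 0 w (pr p) • wedge dy dz + pd 1 w (pr p) • wedge dz dx
        + pd 2 (expw u w) (pr p) • wedge dx dy)
    (hz : ∀ q ∈ V, pd 2 (expw u w) q = 0) :
    Gray3On (total V) (metric u w θ) (JJ u w θ) ↔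
      ∀ q ∈ V, w q * pd 0 (pd 2 w) q = 2 * pd 2 w q * pd 0 w q ∧
        w q * pd 1 (pd 2 w) q = 2 * pd 2 w q * pd 1 w q := by
  rw [← forall_total, Gray3On]
  refine forall₂_congr fun p hp => ?_
  have hw0 := (hwpos _ hp).ne'
  have hP := isUnit_det_coframe (hθ0 p hp)
  simp only [Rm_metric hV hw hu hwpos heq hθ hθ0 hdθ hz hp,
    coframe_mulVec_JJ (hwpos _ hp) (hθ0 p hp)]
  refine (forall_mulVec hP (Q := fun x y z v => lebrunCurv u w (pr p) x y z v
    = lebrunCurv u w (pr p) (frameJ (w (pr p)) *ᵥ x) (frameJ (w (pr p)) *ᵥ y)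
      (frameJ (w (pr p)) *ᵥ z) (frameJ (w (pr p)) *ᵥ v))).trans ?_
  exact (curvForm_gray₃_iff hw0).trans (and_congr (cC_eq_zero_iff hw0) (cC_eq_zero_iff hw0))

/-- The second Gray condition is the third one together with the vanishing of `R₀₁₀₁ - R₀₂₀₂` and
`R₀₁₀₂`. -/
theorem gray₂On_iff (hV : IsOpen V) (hw : ContDiffOn ℝ ∞ w V) (hu : ContDiffOn ℝ ∞ u V)
    (hwpos : ∀ q ∈ V, 0 < w q)
    (heq : ∀ q ∈ V, pd 0 (pd 0 w) q + pd 1 (pd 1 w) q + pd 2 (pd 2 (expw u w)) q = 0)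
    (hθ : ∀ i, ContDiffOn ℝ ∞ (fun p => θ p i) (total V))
    (hθ0 : ∀ p ∈ total V, θ p 0 ≠ 0)
    (hdθ : ∀ p ∈ total V,
      d₁ θ p = pd 0 w (pr p) • wedge dy dz + pd 1 w (pr p) • wedge dz dx
        + pd 2 (expw u w) (pr p) • wedge dx dy)
    (hz : ∀ q ∈ V, pd 2 (expw u w) q = 0) :
    Gray2On (total V) (metric u w θ) (JJ u w θ) ↔
      ∀ q ∈ V, (w q * pd 0 (pd 2 w) q = 2 * pd 2 w q * pd 0 w q ∧
        w q * pd 1 (pd 2 w) q = 2 * pd 2 w q * pd 1 w q) ∧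
        w q * (pd 0 w q * pd 0 u q - pd 1 w q * pd 1 u q) + 3 * (pd 0 w q ^ 2 - pd 1 w q ^ 2)
          = 2 * w q * pd 0 (pd 0 w) q ∧
        w q * (pd 1 w q * pd 0 u q + pd 0 w q * pd 1 u q) + 6 * (pd 0 w q * pd 1 w q)
          = 2 * w q * pd 0 (pd 1 w) q := by
  rw [← forall_total, Gray2On]
  refine forall₂_congr fun p hp => ?_
  have hw0 := (hwpos _ hp).ne'
  have hP := isUnit_det_coframe (hθ0 p hp)
  simp only [Rm_metric hV hw hu hwpos heq hθ hθ0 hdθ hz hp,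
    coframe_mulVec_JJ (hwpos _ hp) (hθ0 p hp)]
  refine (forall_mulVec hP (Q := fun x y z v => lebrunCurv u w (pr p) x y z v
    - lebrunCurv u w (pr p) (frameJ (w (pr p)) *ᵥ x) (frameJ (w (pr p)) *ᵥ y) z v
    = lebrunCurv u w (pr p) (frameJ (w (pr p)) *ᵥ x) y (frameJ (w (pr p)) *ᵥ z) v
    + lebrunCurv u w (pr p) (frameJ (w (pr p)) *ᵥ x) y z (frameJ (w (pr p)) *ᵥ v))).trans ?_
  refine (curvForm_gray₂_iff hw0).trans
    (and_congr (and_congr (cC_eq_zero_iff hw0) (cC_eq_zero_iff hw0)) ?_)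
  have dw := differentiableAt_of_smooth hV hw hp
  have du := differentiableAt_of_smooth hV hu hp
  rw [pd_expw 0 dw du, pd_expw 1 dw du, expw]
  have he := (Real.exp_pos (u (pr p))).ne'
  simp only [cA, cB]
  refine and_congr ?_ ?_
  · field_simp
    constructor <;> intro h <;> linarith
  · field_simp
    constructor <;> intro h <;> linarith

end GrayEquations

/-! ### Functions with vanishing derivatives, and planar harmonic functions -/

section Analysis

theorem fderiv_eq_sum_pd {n : ℕ} (f : (Fin n → ℝ) → ℝ) (p v : Fin n → ℝ) :
    fderiv ℝ f p v = ∑ i, v i * pd i f p := by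
  conv_lhs => rw [← Finset.univ_sum_single v, map_sum]
  refine Finset.sum_congr rfl fun i _ => ?_
  rw [show Pi.single i (v i) = v i • (Pi.single i 1 : Fin n → ℝ) by
    rw [← Pi.single_smul, smul_eq_mul, mul_one], map_smul, smul_eq_mul, pd]

theorem eq_of_pd_eq_zero {n : ℕ} {V : Set (Fin n → ℝ)} (hV : IsOpen V) (hV' : IsPreconnected V)
    {f : (Fin n → ℝ) → ℝ} (hf : ContDiffOn ℝ ∞ f V) (h : ∀ q ∈ V, ∀ i, pd i f q = 0)
    {q q' : Fin n → ℝ} (hq : q ∈ V) (hq' : q' ∈ V) : f q = f q' := by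
  refine hV.is_const_of_fderiv_eq_zero (𝕜 := ℝ) hV' (hf.differentiableOn (by simp))
    (fun p hp => ?_) hq hq'
  ext v
  rw [fderiv_eq_sum_pd, Finset.sum_eq_zero fun i _ => by rw [h p hp, mul_zero]]
  rfl

/-- A function with `f_z = 0` is constant on the connected vertical slices. -/
theorem eq_on_slice {B : Set (Fin 3 → ℝ)} (hB : IsOpen B) {f : (Fin 3 → ℝ) → ℝ}
    (hf : ContDiffOn ℝ ∞ f B) (h : ∀ q ∈ B, pd 2 f q = 0) {a b : ℝ}
    (hs : IsPreconnected {z : ℝ | ![a, b, z] ∈ B}) {z z' : ℝ} (hz : ![a, b, z] ∈ B)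
    (hz' : ![a, b, z'] ∈ B) : f ![a, b, z] = f ![a, b, z'] := by
  have hι : ∀ z : ℝ, HasDerivAt (fun z : ℝ => (![a, b, z] : Fin 3 → ℝ)) (Pi.single 2 1) z := by
    intro z
    rw [hasDerivAt_pi]
    intro i
    fin_cases i
    · simpa using hasDerivAt_const z a
    · simpa using hasDerivAt_const z b
    · simpa using hasDerivAt_id' z
  have hd : ∀ z ∈ {z : ℝ | ![a, b, z] ∈ B}, HasDerivAt (fun z : ℝ => f ![a, b, z]) 0 z := by
    intro z hz
    have := (differentiableAt_of_smooth hB hf hz).hasFDerivAt.comp_hasDerivAt z (hι z)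
    rwa [show fderiv ℝ f ![a, b, z] (Pi.single 2 1) = 0 from h _ hz] at this
  have ho : IsOpen {z : ℝ | ![a, b, z] ∈ B} :=
    hB.preimage (continuous_iff_continuousAt.mpr fun z => (hι z).continuousAt)
  exact ho.is_const_of_deriv_eq_zero hs
    (fun z hz => (hd z hz).differentiableAt.differentiableWithinAt) (fun z hz => (hd z hz).deriv)
    hz hz'

/-- The Cauchy–Riemann equations in a horizontal plane: `f - i g` is complex differentiable if
`f_x = -g_y` and `f_y = g_x`. -/
theorem differentiableAt_of_cauchyRiemann {f g : (Fin 3 → ℝ) → ℝ} {c : ℝ} {ζ : ℂ}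
    (hf : DifferentiableAt ℝ f ![ζ.re, ζ.im, c]) (hg : DifferentiableAt ℝ g ![ζ.re, ζ.im, c])
    (h1 : pd 0 f ![ζ.re, ζ.im, c] = -pd 1 g ![ζ.re, ζ.im, c])
    (h2 : pd 1 f ![ζ.re, ζ.im, c] = pd 0 g ![ζ.re, ζ.im, c]) :
    DifferentiableAt ℂ (fun ζ : ℂ => (f ![ζ.re, ζ.im, c] : ℂ) - Complex.I * g ![ζ.re, ζ.im, c])
      ζ := by
  let L : ℂ →L[ℝ] (Fin 3 → ℝ) :=
    ContinuousLinearMap.pi ![Complex.reCLM, Complex.imCLM, 0]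
  have hL : HasFDerivAt (fun ζ : ℂ => (![ζ.re, ζ.im, c] : Fin 3 → ℝ)) L ζ := by
    rw [hasFDerivAt_pi']
    intro i
    fin_cases i
    · exact Complex.reCLM.hasFDerivAt
    · exact Complex.imCLM.hasFDerivAt
    · exact hasFDerivAt_const c ζ
  have hF := fun {k : (Fin 3 → ℝ) → ℝ} (hk : DifferentiableAt ℝ k ![ζ.re, ζ.im, c]) =>
    Complex.ofRealCLM.hasFDerivAt.comp ζ (hk.hasFDerivAt.comp ζ hL)
  have hFL : ∀ (k : (Fin 3 → ℝ) → ℝ) (v : ℂ), fderiv ℝ k ![ζ.re, ζ.im, c] (L v)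
      = v.re * pd 0 k ![ζ.re, ζ.im, c] + v.im * pd 1 k ![ζ.re, ζ.im, c] := fun k v => by
    rw [fderiv_eq_sum_pd, Fin.sum_univ_three]
    simp [L]
  have h := (hF hf).sub ((hF hg).const_mul Complex.I)
  refine (hasFDerivAt_of_restrictScalars (𝕜 := ℝ) (f' := ContinuousLinearMap.toSpanSingleton ℂ
    ((pd 0 f ![ζ.re, ζ.im, c] : ℂ) - Complex.I * pd 1 f ![ζ.re, ζ.im, c])) h ?_).differentiableAt
  ext v
  apply Complex.ext
  · simp [hFL, h1, h2]
  · simp [hFL, h1, h2]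
    ring

/-- Unique continuation: a solution `(f, g)` of the Cauchy–Riemann equations in a horizontal plane
that vanishes near a point of a ball vanishes throughout the plane section of the ball. -/
theorem cauchyRiemann_unique {f g : (Fin 3 → ℝ) → ℝ} {q₀ : Fin 3 → ℝ} {r : ℝ}
    (hf : ContDiffOn ℝ ∞ f (Metric.ball q₀ r)) (hg : ContDiffOn ℝ ∞ g (Metric.ball q₀ r))
    (h1 : ∀ q ∈ Metric.ball q₀ r, pd 0 f q = -pd 1 g q)
    (h2 : ∀ q ∈ Metric.ball q₀ r, pd 1 f q = pd 0 g q) {a b c : ℝ}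
    (hab : ![a, b, c] ∈ Metric.ball q₀ r)
    (h0 : ∀ᶠ q in nhds ![a, b, c], f q = 0 ∧ g q = 0) {x y : ℝ}
    (hxy : ![x, y, c] ∈ Metric.ball q₀ r) : f ![x, y, c] = 0 ∧ g ![x, y, c] = 0 := by
  have hι : Continuous fun ζ : ℂ => (![ζ.re, ζ.im, c] : Fin 3 → ℝ) := by fun_prop
  set U : Set ℂ := {ζ | ![ζ.re, ζ.im, c] ∈ Metric.ball q₀ r} with hU
  have hUo : IsOpen U := Metric.isOpen_ball.preimage hι
  have hUc : Convex ℝ U := by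
    intro ζ hζ ξ hξ s t hs ht hst
    have := convex_ball q₀ r hζ hξ hs ht hst
    have e : ![(s • ζ + t • ξ).re, (s • ζ + t • ξ).im, c]
        = s • ![ζ.re, ζ.im, c] + t • ![ξ.re, ξ.im, c] := by
      ext i
      fin_cases i
      · simp
      · simp
      · simp [← add_mul, hst]
    rw [hU, Set.mem_ofPred_eq, e]
    exact this
  set F : ℂ → ℂ := fun ζ => (f ![ζ.re, ζ.im, c] : ℂ) - Complex.I * g ![ζ.re, ζ.im, c] with hF
  have hd : DifferentiableOn ℂ F U := fun ζ hζ =>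
    (differentiableAt_of_cauchyRiemann (differentiableAt_of_smooth Metric.isOpen_ball hf hζ)
      (differentiableAt_of_smooth Metric.isOpen_ball hg hζ) (h1 _ hζ)
      (h2 _ hζ)).differentiableWithinAt
  have hz : F =ᶠ[nhds (⟨a, b⟩ : ℂ)] 0 := by
    have : Filter.Tendsto (fun ζ : ℂ => (![ζ.re, ζ.im, c] : Fin 3 → ℝ)) (nhds (⟨a, b⟩ : ℂ))
        (nhds ![a, b, c]) := hι.tendsto _
    filter_upwards [this.eventually h0] with ζ hζ
    simp [hF, hζ.1, hζ.2]
  have := (hd.analyticOnNhd hUo).eqOn_zero_of_preconnected_of_eventuallyEq_zero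
    hUc.isPreconnected (z₀ := ⟨a, b⟩) hab hz (x := ⟨x, y⟩) hxy
  have e1 := congrArg Complex.re this
  have e2 := congrArg Complex.im this
  simp [hF] at e1 e2
  exact ⟨e1, e2⟩

theorem vec_eta (q : Fin 3 → ℝ) : ![q 0, q 1, q 2] = q := by
  ext i
  fin_cases i <;> rfl

variable {V : Set (Fin 3 → ℝ)} {w u : (Fin 3 → ℝ) → ℝ}

/-- The functions `w_x / w²` and `w_y / w²` do not depend on `z`. -/
theorem pd_two_div_sq (hV : IsOpen V) (hw : ContDiffOn ℝ ∞ w V) (hwpos : ∀ q ∈ V, 0 < w q)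
    {i : Fin 3} {q : Fin 3 → ℝ} (hq : q ∈ V)
    (h : w q * pd i (pd 2 w) q = 2 * pd 2 w q * pd i w q) :
    pd 2 (fun q => pd i w q / w q ^ 2) q = 0 := by
  have dw := differentiableAt_of_smooth hV hw hq
  have di := differentiableAt_of_smooth hV (contDiffOn_pd hV hw i) hq
  have hw0 := (hwpos q hq).ne'
  rw [pd_div 2 di (dw.fun_pow 2) (pow_ne_zero 2 hw0), pd_pow 2 dw, pd_comm hV hw hq 2 i]
  push_cast
  field_simp
  linear_combination h

/-- Pointwise consequence of the third Gray condition: with `v = 1/w`, both `∇v` (in the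
`(x, y)`-plane) and `Δv` are independent of `z`, so differentiating `v Δv = 2 |∇v|²` in `z` gives
`v_z Δv = 0`. -/
theorem pd_two_mul_grad_eq_zero (hV : IsOpen V) (hw : ContDiffOn ℝ ∞ w V)
    (hwpos : ∀ q ∈ V, 0 < w q) (hharm : ∀ q ∈ V, pd 0 (pd 0 w) q + pd 1 (pd 1 w) q = 0)
    (h3 : ∀ q ∈ V, w q * pd 0 (pd 2 w) q = 2 * pd 2 w q * pd 0 w q ∧
      w q * pd 1 (pd 2 w) q = 2 * pd 2 w q * pd 1 w q) {q : Fin 3 → ℝ} (hq : q ∈ V) :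
    pd 2 w q * (pd 0 w q ^ 2 + pd 1 w q ^ 2) = 0 := by
  have dw := fun {q} (hq : q ∈ V) => differentiableAt_of_smooth hV hw hq
  have dw1 := fun i {q} (hq : q ∈ V) => differentiableAt_of_smooth hV (contDiffOn_pd hV hw i) hq
  set a : (Fin 3 → ℝ) → ℝ := fun q => pd 0 w q / w q ^ 2 with ha
  set b : (Fin 3 → ℝ) → ℝ := fun q => pd 1 w q / w q ^ 2 with hb
  have w2 : ∀ q ∈ V, w q ^ 2 ≠ 0 := fun q hq => pow_ne_zero 2 (hwpos q hq).ne'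
  have sa : ContDiffOn ℝ ∞ a V := (contDiffOn_pd hV hw 0).div (hw.pow 2) w2
  have sb : ContDiffOn ℝ ∞ b V := (contDiffOn_pd hV hw 1).div (hw.pow 2) w2
  have a2 : ∀ q ∈ V, pd 2 a q = 0 := fun q hq => pd_two_div_sq hV hw hwpos hq (h3 q hq).1
  have b2 : ∀ q ∈ V, pd 2 b q = 0 := fun q hq => pd_two_div_sq hV hw hwpos hq (h3 q hq).2
  have key : ∀ q ∈ V, pd 0 a q + pd 1 b q + 2 * w q * (a q ^ 2 + b q ^ 2) = 0 := by
    intro q hq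
    have hw0 := (hwpos q hq).ne'
    rw [ha, hb, pd_div 0 (dw1 0 hq) ((dw hq).fun_pow 2) (w2 q hq),
      pd_div 1 (dw1 1 hq) ((dw hq).fun_pow 2) (w2 q hq), pd_pow 0 (dw hq), pd_pow 1 (dw hq)]
    push_cast
    field_simp
    linear_combination w q * hharm q hq
  have da := differentiableAt_of_smooth hV sa hq
  have db := differentiableAt_of_smooth hV sb hq
  have da0 := differentiableAt_of_smooth hV (contDiffOn_pd hV sa 0) hq
  have db1 := differentiableAt_of_smooth hV (contDiffOn_pd hV sb 1) hq
  have dw' := dw hq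
  have e := pd_eq_zero_of_eqOn hV key hq 2
  rw [pd_add, pd_add, pd_mul, pd_mul, pd_add, pd_pow 2 da, pd_pow 2 db, pd_const, pd_comm hV sa hq,
    pd_comm hV sb hq, pd_eq_zero_of_eqOn hV a2 hq, pd_eq_zero_of_eqOn hV b2 hq, a2 q hq,
    b2 q hq] at e
  · have e' : pd 2 w q * (a q ^ 2 + b q ^ 2) = 0 := by linear_combination e / 2
    have hw0 := (hwpos q hq).ne'
    simp only [ha, hb] at e'
    field_simp at e'
    linear_combination e'
  all_goals fun_prop

/-- If `w_x` and `w_y` do not both vanish identically, then the third Gray condition forces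
`w_z = 0` on the connected set `V`: by unique continuation the set where the horizontal gradient is
nonzero is dense. -/
theorem pd_two_eq_zero (hV : IsOpen V) (hVc : IsPreconnected V) (hw : ContDiffOn ℝ ∞ w V)
    (hwpos : ∀ q ∈ V, 0 < w q) (hharm : ∀ q ∈ V, pd 0 (pd 0 w) q + pd 1 (pd 1 w) q = 0)
    (h3 : ∀ q ∈ V, w q * pd 0 (pd 2 w) q = 2 * pd 2 w q * pd 0 w q ∧
      w q * pd 1 (pd 2 w) q = 2 * pd 2 w q * pd 1 w q)
    (hne : ∃ q ∈ V, ¬(pd 0 w q = 0 ∧ pd 1 w q = 0)) {q : Fin 3 → ℝ} (hq : q ∈ V) :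
    pd 2 w q = 0 := by
  set S : Set (Fin 3 → ℝ) := {q | q ∈ V ∧ ¬(pd 0 w q = 0 ∧ pd 1 w q = 0)} with hS
  have c0 := (contDiffOn_pd hV hw 0).continuousOn
  have c1 := (contDiffOn_pd hV hw 1).continuousOn
  have c2 := (contDiffOn_pd hV hw 2).continuousOn
  have hSo : IsOpen S := by
    have : S = V ∩ (fun q => (pd 0 w q, pd 1 w q)) ⁻¹' {(0, 0)}ᶜ := by
      ext q
      simp [hS]
    rw [this]
    exact (c0.prodMk c1).isOpen_inter_preimage hV isOpen_compl_singleton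
  have hball : ∀ q₀ r, Metric.ball q₀ r ⊆ V → (Metric.ball q₀ r ∩ S).Nonempty →
      Metric.ball q₀ r ⊆ closure S := by
    rintro q₀ r hr ⟨s, hs, hsV, hs0⟩ q hq
    by_contra hcl
    apply hs0
    -- `w_x / w²` and `w_y / w²` are constant in `z` on the ball
    have hzero : ∀ i : Fin 3, (∀ q ∈ V, w q * pd i (pd 2 w) q = 2 * pd 2 w q * pd i w q) →
        ∀ x y z z', ![x, y, z] ∈ Metric.ball q₀ r → ![x, y, z'] ∈ Metric.ball q₀ r →
        pd i w ![x, y, z] = 0 → pd i w ![x, y, z'] = 0 := by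
      intro i hi x y z z' hz hz' h0
      have hpre : IsPreconnected {z : ℝ | ![x, y, z] ∈ Metric.ball q₀ r} := by
        refine Convex.isPreconnected fun ζ hζ ξ hξ s t hs ht hst => ?_
        have := convex_ball q₀ r hζ hξ hs ht hst
        have e : ![x, y, s • ζ + t • ξ] = s • ![x, y, ζ] + t • ![x, y, ξ] := by
          ext i
          fin_cases i
          · simp [← add_mul, hst]
          · simp [← add_mul, hst]
          · simp
        rw [Set.mem_ofPred_eq, e]
        exact this
      have e := eq_on_slice Metric.isOpen_ball (f := fun q => pd i w q / w q ^ 2)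
        (((contDiffOn_pd hV hw i).div (hw.pow 2)
          fun q hq => pow_ne_zero 2 (hwpos q hq).ne').mono hr)
        (fun q hq => pd_two_div_sq hV hw hwpos (hr hq) (hi q (hr hq))) hpre hz hz'
      have hw0 := (hwpos _ (hr hz')).ne'
      simp only [h0, zero_div] at e
      rcases div_eq_zero_iff.mp e.symm with h | h
      · exact h
      · exact absurd h (pow_ne_zero 2 hw0)
    have hq' : ∀ᶠ p in nhds q, p ∈ Metric.ball q₀ r ∧ pd 0 w p = 0 ∧ pd 1 w p = 0 := by
      filter_upwards [Metric.isOpen_ball.mem_nhds hq, isClosed_closure.isOpen_compl.mem_nhds hcl]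
        with p hp hp'
      by_contra hn
      exact hp' (subset_closure ⟨hr hp, fun h => hn ⟨hp, h⟩⟩)
    -- move the zero set from the height `q 2` to the height `s 2`
    have hmem : ![q 0, q 1, s 2] ∈ Metric.ball q₀ r := by
      have hr0 : 0 < r := dist_nonneg.trans_lt (Metric.mem_ball.mp hq)
      rw [Metric.mem_ball, dist_pi_lt_iff hr0] at hs hq ⊢
      intro i
      fin_cases i
      · exact hq 0
      · exact hq 1
      · exact hs 2
    have hlift : Filter.Tendsto (fun p : Fin 3 → ℝ => ![p 0, p 1, q 2]) (nhds ![q 0, q 1, s 2])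
        (nhds q) := by
      have hc : Continuous fun p : Fin 3 → ℝ => (![p 0, p 1, q 2] : Fin 3 → ℝ) := by fun_prop
      have := hc.tendsto ![q 0, q 1, s 2]
      simpa only [Matrix.cons_val, vec_eta] using this
    have h0 : ∀ᶠ p in nhds ![q 0, q 1, s 2], pd 0 w p = 0 ∧ pd 1 w p = 0 := by
      filter_upwards [hlift.eventually hq', Metric.isOpen_ball.mem_nhds hmem] with p hp hpb
      rw [← vec_eta p] at hpb ⊢
      exact ⟨hzero 0 (fun q hq => (h3 q hq).1) _ _ _ _ hp.1 hpb hp.2.1,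
        hzero 1 (fun q hq => (h3 q hq).2) _ _ _ _ hp.1 hpb hp.2.2⟩
    have := cauchyRiemann_unique ((contDiffOn_pd hV hw 0).mono hr) ((contDiffOn_pd hV hw 1).mono hr)
      (fun q hq => by linarith [hharm q (hr hq)])
      (fun q hq => pd_comm hV hw (hr hq) 1 0) hmem h0 (x := s 0) (y := s 1)
      (by rwa [vec_eta])
    rwa [vec_eta] at this
  have hdense : V ⊆ interior (closure S) := by
    refine hVc.subset_of_closure_inter_subset isOpen_interior ?_ ?_
    · obtain ⟨q, hq, h⟩ := hne
      exact ⟨q, hq, interior_maximal subset_closure hSo ⟨hq, h⟩⟩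
    · rintro q ⟨hqc, hqV⟩
      obtain ⟨r, hr0, hr⟩ := Metric.isOpen_iff.mp hV q hqV
      have hqS : q ∈ closure S := closure_minimal interior_subset isClosed_closure hqc
      have hne' := mem_closure_iff.mp hqS _ Metric.isOpen_ball (Metric.mem_ball_self hr0)
      exact interior_maximal (hball q r hr hne') Metric.isOpen_ball (Metric.mem_ball_self hr0)
  by_contra hq0
  have hO : IsOpen (V ∩ pd 2 w ⁻¹' {0}ᶜ) := c2.isOpen_inter_preimage hV isOpen_compl_singleton
  obtain ⟨s, ⟨hsV, hs2⟩, -, hs⟩ :=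
    mem_closure_iff.mp (interior_subset (hdense hq)) _ hO ⟨hq, hq0⟩
  rcases mul_eq_zero.mp (pd_two_mul_grad_eq_zero hV hw hwpos hharm h3 hsV) with h | h
  · exact hs2 h
  · exact hs ⟨by nlinarith [sq_nonneg (pd 0 w s), sq_nonneg (pd 1 w s)],
      by nlinarith [sq_nonneg (pd 0 w s), sq_nonneg (pd 1 w s)]⟩

end Analysis

/-! ### Descent to the `(x, y)`-plane -/

section Descent

variable {V : Set (Fin 3 → ℝ)}

theorem contDiff_lift (c : ℝ) : ContDiff ℝ ∞ fun r : Fin 2 → ℝ => (![r 0, r 1, c] : Fin 3 → ℝ) := by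
  rw [contDiff_pi]
  intro i
  fin_cases i
  · exact contDiff_apply ℝ ℝ 0
  · exact contDiff_apply ℝ ℝ 1
  · exact contDiff_const

theorem lift_prXY (q : Fin 3 → ℝ) : ![prXY q 0, prXY q 1, q 2] = q := vec_eta q

theorem prXY_lift (r : Fin 2 → ℝ) (c : ℝ) : prXY ![r 0, r 1, c] = r := by
  ext i
  fin_cases i <;> rfl

theorem isOpen_image_prXY (hV : IsOpen V) : IsOpen (prXY '' V) := by
  rw [isOpen_iff_mem_nhds]
  rintro _ ⟨q, hq, rfl⟩
  have hc := (contDiff_lift (q 2)).continuous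
  have : (fun r : Fin 2 → ℝ => (![r 0, r 1, q 2] : Fin 3 → ℝ)) ⁻¹' V ∈ nhds (prXY q) :=
    (hV.preimage hc).mem_nhds (by rwa [Set.mem_preimage, lift_prXY])
  filter_upwards [this] with r hr
  exact ⟨_, hr, prXY_lift r _⟩

/-- A smooth function with `f_z = 0` descends to the projection of `V` if the vertical slices of `V`
are connected. -/
theorem exists_descent (hV : IsOpen V)
    (hs : ∀ a b : ℝ, IsPreconnected {z : ℝ | ![a, b, z] ∈ V}) {f : (Fin 3 → ℝ) → ℝ}
    (hf : ContDiffOn ℝ ∞ f V) (h : ∀ q ∈ V, pd 2 f q = 0) :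
    ∃ W : (Fin 2 → ℝ) → ℝ, ContDiffOn ℝ ∞ W (prXY '' V) ∧ ∀ q ∈ V, f q = W (prXY q) := by
  classical
  let σ : (Fin 2 → ℝ) → Fin 3 → ℝ := fun r => if hr : r ∈ prXY '' V then hr.choose else 0
  have hσ : ∀ r ∈ prXY '' V, σ r ∈ V ∧ prXY (σ r) = r := fun r hr => by
    simp only [σ, dif_pos hr]
    exact hr.choose_spec
  have key : ∀ q ∈ V, f q = f (σ (prXY q)) := fun q hq => by
    obtain ⟨h1, h2⟩ := hσ _ ⟨q, hq, rfl⟩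
    have e : ![prXY q 0, prXY q 1, σ (prXY q) 2] = σ (prXY q) := by
      conv_rhs => rw [← lift_prXY (σ (prXY q)), h2]
    have := eq_on_slice hV hf h (hs (prXY q 0) (prXY q 1)) (z := q 2) (z' := σ (prXY q) 2)
      (by rwa [lift_prXY]) (by rwa [e])
    rwa [lift_prXY, e] at this
  refine ⟨fun r => f (σ r), ?_, key⟩
  rintro _ ⟨q, hq, rfl⟩
  apply ContDiffAt.contDiffWithinAt
  have hc := (contDiff_lift (q 2)).continuous
  have hmem : (fun r : Fin 2 → ℝ => (![r 0, r 1, q 2] : Fin 3 → ℝ)) ⁻¹' V ∈ nhds (prXY q) :=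
    (hV.preimage hc).mem_nhds (by rwa [Set.mem_preimage, lift_prXY])
  have h1 : ContDiffAt ℝ ∞ (fun r : Fin 2 → ℝ => f ![r 0, r 1, q 2]) (prXY q) := by
    refine ContDiffAt.comp (prXY q) ?_ (contDiff_lift (q 2)).contDiffAt
    rw [lift_prXY]
    exact hf.contDiffAt (hV.mem_nhds hq)
  refine h1.congr_of_eventuallyEq ?_
  filter_upwards [hmem] with r hr
  rw [key _ hr, prXY_lift]

theorem pd_comp_prXY {F : (Fin 2 → ℝ) → ℝ} {q : Fin 3 → ℝ} (hF : DifferentiableAt ℝ F (prXY q)) :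
    pd 0 (fun q => F (prXY q)) q = pd 0 F (prXY q) ∧
      pd 1 (fun q => F (prXY q)) q = pd 1 F (prXY q) ∧ pd 2 (fun q => F (prXY q)) q = 0 := by
  let L : (Fin 3 → ℝ) →L[ℝ] (Fin 2 → ℝ) := ContinuousLinearMap.pi
    ![ContinuousLinearMap.proj (R := ℝ) (φ := fun _ : Fin 3 => ℝ) 0,
      ContinuousLinearMap.proj (R := ℝ) (φ := fun _ : Fin 3 => ℝ) 1]
  have hL : HasFDerivAt prXY L q := by
    have : prXY = L := by
      ext q i
      fin_cases i <;> rfl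
    rw [this]
    exact L.hasFDerivAt
  have h : ∀ i, pd i (fun q => F (prXY q)) q = fderiv ℝ F (prXY q) (L (Pi.single i 1)) :=
    fun i => congrArg (fun A => A (Pi.single i 1)) (hF.hasFDerivAt.comp q hL).fderiv
  simp only [h, fderiv_eq_sum_pd, Fin.sum_univ_two]
  simp [L]

/-- The derivatives of a function on `V` that descends to the plane. -/
theorem pd_of_descent (hV : IsOpen V) {f : (Fin 3 → ℝ) → ℝ} {F : (Fin 2 → ℝ) → ℝ}
    (hF : ContDiffOn ℝ ∞ F (prXY '' V)) (hf : ∀ q ∈ V, f q = F (prXY q)) {q : Fin 3 → ℝ}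
    (hq : q ∈ V) :
    pd 0 f q = pd 0 F (prXY q) ∧ pd 1 f q = pd 1 F (prXY q) ∧ pd 2 f q = 0 := by
  simp only [pd_congr_on hV hf hq]
  exact pd_comp_prXY (differentiableAt_of_smooth (isOpen_image_prXY hV) hF ⟨q, hq, rfl⟩)

theorem laplacian_of_descent (hV : IsOpen V) {f : (Fin 3 → ℝ) → ℝ} {F : (Fin 2 → ℝ) → ℝ}
    (hF : ContDiffOn ℝ ∞ F (prXY '' V)) (hf : ∀ q ∈ V, f q = F (prXY q)) {q : Fin 3 → ℝ}
    (hq : q ∈ V) :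
    pd 0 (pd 0 f) q + pd 1 (pd 1 f) q
      = pd 0 (pd 0 F) (prXY q) + pd 1 (pd 1 F) (prXY q) := by
  have hU := isOpen_image_prXY hV
  rw [(pd_of_descent hV (contDiffOn_pd hU hF 0) (fun q hq => (pd_of_descent hV hF hf hq).1) hq).1,
    (pd_of_descent hV (contDiffOn_pd hU hF 1) (fun q hq => (pd_of_descent hV hF hf hq).2.1)
      hq).2.1]

end Descent

/-! ### The equations for the classes `𝒜𝒦₃` and `𝒜𝒦₂` -/

section Equations

variable {V : Set (Fin 3 → ℝ)} {w u : (Fin 3 → ℝ) → ℝ}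

theorem exists_ne_iff (hV : IsOpen V) (hVc : IsPreconnected V) (hw : ContDiffOn ℝ ∞ w V)
    (hz : ∀ q ∈ V, pd 2 w q = 0) :
    (∃ q ∈ V, ∃ q' ∈ V, w q ≠ w q') ↔ ∃ q ∈ V, ¬(pd 0 w q = 0 ∧ pd 1 w q = 0) := by
  constructor
  · rintro ⟨q, hq, q', hq', hne⟩
    by_contra! h
    refine hne (eq_of_pd_eq_zero hV hVc hw (fun p hp i => ?_) hq hq')
    fin_cases i
    · exact (h p hp).1
    · exact (h p hp).2
    · exact hz p hp
  · rintro ⟨q, hq, hne⟩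
    by_contra! h
    have : ∀ i, pd i w q = 0 := fun i => by
      rw [pd_congr_on hV (g := fun _ => w q) (fun p hp => h p hp q hq) hq, pd_const]
    exact hne ⟨this 0, this 1⟩

theorem pd_two_u_eq_zero_iff {q : Fin 3 → ℝ} (dw : DifferentiableAt ℝ w q)
    (du : DifferentiableAt ℝ u q) (hw0 : 0 < w q) (hz : pd 2 w q = 0) :
    pd 2 u q = 0 ↔ pd 2 (expw u w) q = 0 := by
  rw [pd_expw 2 dw du, hz, add_zero]
  simp [hw0.ne']

/-- Multiplied by the horizontal gradient of `w`, the additional equations of the second Gray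
condition say that `ρ = (w_x² + w_y²) e^{-u} w⁻³` has zero derivative. On the connected set `V` it
is then constant, and positive once it is so at one point, which excludes critical points of `w`. -/
theorem gray₂_equations_iff (hV : IsOpen V) (hVc : IsPreconnected V) (hVne : V.Nonempty)
    (hw : ContDiffOn ℝ ∞ w V) (hu : ContDiffOn ℝ ∞ u V) (hwpos : ∀ q ∈ V, 0 < w q)
    (hharm : ∀ q ∈ V, pd 0 (pd 0 w) q + pd 1 (pd 1 w) q = 0)
    (hwz : ∀ q ∈ V, pd 2 w q = 0) (huz : ∀ q ∈ V, pd 2 u q = 0) :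
    ((∃ q ∈ V, ¬(pd 0 w q = 0 ∧ pd 1 w q = 0)) ∧ ∀ q ∈ V,
        w q * (pd 0 w q * pd 0 u q - pd 1 w q * pd 1 u q) + 3 * (pd 0 w q ^ 2 - pd 1 w q ^ 2)
          = 2 * w q * pd 0 (pd 0 w) q ∧
        w q * (pd 1 w q * pd 0 u q + pd 0 w q * pd 1 u q) + 6 * (pd 0 w q * pd 1 w q)
          = 2 * w q * pd 0 (pd 1 w) q) ↔
      (∀ q ∈ V, ¬(pd 0 w q = 0 ∧ pd 1 w q = 0)) ∧
        ∃ c : ℝ, ∀ q ∈ V,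
          u q = Real.log (pd 0 w q ^ 2 + pd 1 w q ^ 2) - 3 * Real.log (w q) + c := by
  have s0 := contDiffOn_pd hV hw 0
  have s1 := contDiffOn_pd hV hw 1
  have hsq : ∀ q, ¬(pd 0 w q = 0 ∧ pd 1 w q = 0) → 0 < pd 0 w q ^ 2 + pd 1 w q ^ 2 := fun q h => by
    rcases not_and_or.mp h with h | h <;> positivity
  constructor
  · rintro ⟨⟨q₀, hq₀, hne⟩, h⟩
    set ρ : (Fin 3 → ℝ) → ℝ :=
      fun q => (pd 0 w q ^ 2 + pd 1 w q ^ 2) * (Real.exp (-u q) * (w q ^ 3)⁻¹) with hρ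
    have w3 : ∀ q ∈ V, w q ^ 3 ≠ 0 := fun q hq => pow_ne_zero 3 (hwpos q hq).ne'
    have hρs : ContDiffOn ℝ ∞ ρ V := ((s0.pow 2).add (s1.pow 2)).mul
      (hu.neg.exp.mul ((hw.pow 3).inv w3))
    have hρ0 : ∀ q ∈ V, ∀ i, pd i ρ q = 0 := by
      intro q hq i
      have dw := differentiableAt_of_smooth hV hw hq
      have du := differentiableAt_of_smooth hV hu hq
      have d0 := differentiableAt_of_smooth hV s0 hq
      have d1 := differentiableAt_of_smooth hV s1 hq
      have d3 := (dw.fun_pow 3).fun_inv (w3 q hq)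
      have hw0 := (hwpos q hq).ne'
      -- the identity `d log (w_x² + w_y²) = du + 3 d log w`, cleared of denominators
      have e : w q * (2 * pd 0 w q * pd i (pd 0 w) q + 2 * pd 1 w q * pd i (pd 1 w) q)
          = (pd 0 w q ^ 2 + pd 1 w q ^ 2) * (w q * pd i u q + 3 * pd i w q) := by
        obtain ⟨h1, h2⟩ := h q hq
        have c10 := pd_comm hV hw hq 1 0
        have hh := hharm q hq
        revert i
        simp only [Fin.forall_fin_succ, IsEmpty.forall_iff, and_true]
        refine ⟨?_, ?_, ?_⟩
        · linear_combination -(pd 0 w q) * h1 - pd 1 w q * h2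
        · change w q * (2 * pd 0 w q * pd 1 (pd 0 w) q + 2 * pd 1 w q * pd 1 (pd 1 w) q)
            = (pd 0 w q ^ 2 + pd 1 w q ^ 2) * (w q * pd 1 u q + 3 * pd 1 w q)
          rw [c10]
          linear_combination (pd 1 w q) * h1 - pd 0 w q * h2 + 2 * w q * pd 1 w q * hh
        · change w q * (2 * pd 0 w q * pd 2 (pd 0 w) q + 2 * pd 1 w q * pd 2 (pd 1 w) q)
            = (pd 0 w q ^ 2 + pd 1 w q ^ 2) * (w q * pd 2 u q + 3 * pd 2 w q)
          rw [pd_comm hV hw hq 2 0, pd_comm hV hw hq 2 1, pd_eq_zero_of_eqOn hV hwz hq,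
            pd_eq_zero_of_eqOn hV hwz hq, hwz q hq, huz q hq]
          ring
      have dn : DifferentiableAt ℝ (fun q => -u q) q := du.fun_neg
      rw [hρ, pd_mul i ((d0.fun_pow 2).fun_add (d1.fun_pow 2)) (dn.exp.fun_mul d3),
        pd_add i (d0.fun_pow 2) (d1.fun_pow 2), pd_pow i d0, pd_pow i d1, pd_mul i dn.exp d3,
        pd_exp i dn, pd_neg, pd_inv i (dw.fun_pow 3) (w3 q hq), pd_pow i dw]
      push_cast
      field_simp
      linear_combination Real.exp (-u q) * e
    have hconst : ∀ q ∈ V, ρ q = ρ q₀ := fun q hq => eq_of_pd_eq_zero hV hVc hρs hρ0 hq hq₀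
    have hpos : 0 < ρ q₀ := mul_pos (hsq _ hne)
      (mul_pos (Real.exp_pos _) (inv_pos.mpr (pow_pos (hwpos _ hq₀) 3)))
    have hne' : ∀ q ∈ V, ¬(pd 0 w q = 0 ∧ pd 1 w q = 0) := by
      rintro q hq ⟨h0, h1⟩
      have : ρ q = 0 := by simp [hρ, h0, h1]
      exact hpos.ne' ((hconst q hq).symm.trans this)
    refine ⟨hne', -Real.log (ρ q₀), fun q hq => ?_⟩
    rw [← hconst q hq, hρ]
    simp only
    rw [Real.log_mul (hsq q (hne' q hq)).ne'
      (mul_ne_zero (Real.exp_pos _).ne' (inv_ne_zero (w3 q hq))),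
      Real.log_mul (Real.exp_pos _).ne' (inv_ne_zero (w3 q hq)), Real.log_exp, Real.log_inv,
      Real.log_pow]
    push_cast
    ring
  · rintro ⟨hne, c, hc⟩
    obtain ⟨q₀, hq₀⟩ := hVne
    refine ⟨⟨q₀, hq₀, hne q₀ hq₀⟩, fun q hq => ?_⟩
    have dw := differentiableAt_of_smooth hV hw hq
    have d0 := differentiableAt_of_smooth hV s0 hq
    have d1 := differentiableAt_of_smooth hV s1 hq
    have hw0 := (hwpos q hq).ne'
    have hs := (hsq q (hne q hq)).ne'
    have dsq := (d0.fun_pow 2).fun_add (d1.fun_pow 2)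
    have e : ∀ i, w q * (pd 0 w q ^ 2 + pd 1 w q ^ 2) * pd i u q
        = 2 * w q * (pd 0 w q * pd i (pd 0 w) q + pd 1 w q * pd i (pd 1 w) q)
          - 3 * (pd 0 w q ^ 2 + pd 1 w q ^ 2) * pd i w q := fun i => by
      rw [pd_congr_on hV hc hq, pd_add i ((dsq.log hs).fun_sub ((dw.log hw0).const_mul 3))
        (differentiableAt_const c), pd_sub i (dsq.log hs) ((dw.log hw0).const_mul 3),
        pd_mul i (differentiableAt_const 3) (dw.log hw0), pd_log i dsq hs, pd_log i dw hw0,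
        pd_add i (d0.fun_pow 2) (d1.fun_pow 2), pd_pow i d0, pd_pow i d1, pd_const, pd_const]
      push_cast
      field_simp
      ring
    have e0 := e 0
    have e1 := e 1
    rw [pd_comm hV hw hq 1 0] at e1
    have hh := hharm q hq
    constructor
    · refine mul_left_cancel₀ hs ?_
      linear_combination pd 0 w q * e0 - pd 1 w q * e1 - 2 * w q * pd 1 w q ^ 2 * hh
    · refine mul_left_cancel₀ hs ?_
      linear_combination pd 1 w q * e0 + pd 0 w q * e1 + 2 * w q * pd 0 w q * pd 1 w q * hh

end Equations

/-! ### The almost Kähler and Kähler conditions -/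

section Kahler

variable {V : Set (Fin 3 → ℝ)} {w u : (Fin 3 → ℝ) → ℝ} {θ : (Fin 4 → ℝ) → Fin 4 → ℝ}

theorem isAlmostKahler_iff (hV : IsOpen V) (hw : ContDiffOn ℝ ∞ w V) (hu : ContDiffOn ℝ ∞ u V)
    (hwpos : ∀ q ∈ V, 0 < w q)
    (hθ : ∀ i, ContDiffOn ℝ ∞ (fun p => θ p i) (total V))
    (hθ0 : ∀ p ∈ total V, θ p 0 ≠ 0)
    (hdθ : ∀ p ∈ total V,
      d₁ θ p = pd 0 w (pr p) • wedge dy dz + pd 1 w (pr p) • wedge dz dx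
        + pd 2 (expw u w) (pr p) • wedge dx dy) :
    IsAlmostKahlerOn (total V) (metric u w θ) (JJ u w θ) ↔ ∀ q ∈ V, pd 2 (expw u w) q = 0 := by
  have hd := fun {p} (hp : p ∈ total V) => d₂_fundamentalForm hV hw hu hwpos hθ hθ0 hdθ hp
  constructor
  · rintro ⟨-, h⟩
    refine forall_total.mp fun p hp => ?_
    have := (hd hp 3 1 2).symm.trans (h p hp 3 1 2)
    simpa [dx, dy, dz, wedge] using this
  · intro h
    refine ⟨isAlmostHermitian hw hu hwpos hθ hθ0, fun p hp i j k => ?_⟩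
    rw [hd hp, h _ hp]
    ring

theorem isKahler_iff (hV : IsOpen V) (hw : ContDiffOn ℝ ∞ w V) (hu : ContDiffOn ℝ ∞ u V)
    (hwpos : ∀ q ∈ V, 0 < w q)
    (hθ : ∀ i, ContDiffOn ℝ ∞ (fun p => θ p i) (total V))
    (hθ0 : ∀ p ∈ total V, θ p 0 ≠ 0)
    (hdθ : ∀ p ∈ total V,
      d₁ θ p = pd 0 w (pr p) • wedge dy dz + pd 1 w (pr p) • wedge dz dx
        + pd 2 (expw u w) (pr p) • wedge dx dy) :
    IsKahlerOn (total V) (metric u w θ) (JJ u w θ) ↔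
      (∀ q ∈ V, pd 2 (expw u w) q = 0) ∧ ∀ q ∈ V, pd 0 w q = 0 ∧ pd 1 w q = 0 := by
  have hN := fun {p} (hp : p ∈ total V) => nijenhuis_JJ_values hV hw hwpos hθ hθ0 hdθ hp
  rw [IsKahlerOn, isAlmostKahler_iff hV hw hu hwpos hθ hθ0 hdθ]
  refine and_congr_right fun hz => ⟨fun h => forall_total.mp fun p hp => ?_, fun h p hp i j k => ?_⟩
  · have hw0 := (hwpos _ hp).ne'
    have ha := hθ0 p hp
    have e1 := (hN hp).2.1.symm.trans (h p hp 0 1 3)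
    have e2 := (hN hp).2.2.symm.trans (h p hp 0 2 3)
    simp [hw0, ha] at e1 e2
    exact ⟨e2, e1⟩
  · exact (hN hp).1 (h _ hp).1 (h _ hp).2 (hz _ hp) i j k

end Kahler

end LeBrunAK

theorem proposition1
    (V : Set (Fin 3 → ℝ)) (hVopen : IsOpen V) (hVconn : IsConnected V)
    (w u : (Fin 3 → ℝ) → ℝ)
    (hw : ContDiffOn ℝ ∞ w V) (hu : ContDiffOn ℝ ∞ u V) (hwpos : ∀ q ∈ V, 0 < w q)
    -- the equation `w_xx + w_yy + (w e^u)_zz = 0`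
    (heq : ∀ q ∈ V, pd 0 (pd 0 w) q + pd 1 (pd 1 w) q + pd 2 (pd 2 (expw u w)) q = 0)
    -- the 1-form `θ` on `ℝ × V`, nonvanishing on the `ℝ`-factor, with
    -- `dθ = w_x dy ∧ dz + w_y dz ∧ dx + (w e^u)_z dx ∧ dy`
    (θ : (Fin 4 → ℝ) → Fin 4 → ℝ)
    (hθ : ∀ i, ContDiffOn ℝ ∞ (fun p => θ p i) (total V))
    (hθ0 : ∀ p ∈ total V, θ p 0 ≠ 0)
    (hdθ : ∀ p ∈ total V,
      d₁ θ p = pd 0 w (pr p) • wedge dy dz + pd 1 w (pr p) • wedge dz dx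
        + pd 2 (expw u w) (pr p) • wedge dx dy) :
    -- `(g, J)` is an almost Hermitian structure with fundamental form `Ω_J`
    (IsAlmostHermitianOn (total V) (metric u w θ) (JJ u w θ) ∧
      ∀ p ∈ total V, fundamentalForm (metric u w θ) (JJ u w θ) p = OmegaJ u w θ p) ∧
    -- almost Kähler
    (IsAlmostKahlerOn (total V) (metric u w θ) (JJ u w θ) ↔
      ∀ q ∈ V, pd 2 (expw u w) q = 0) ∧
    -- Kähler
    (IsKahlerOn (total V) (metric u w θ) (JJ u w θ) ↔
      (∀ q ∈ V, pd 2 (expw u w) q = 0) ∧ ∀ q ∈ V, pd 0 w q = 0 ∧ pd 1 w q = 0) ∧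
    -- (i)
    ((¬ IsKahlerOn (total V) (metric u w θ) (JJ u w θ) ∧
        IsAK3On (total V) (metric u w θ) (JJ u w θ)) ↔
      (∀ q ∈ V, pd 2 w q = 0 ∧ pd 2 u q = 0) ∧
      (∀ q ∈ V, pd 0 (pd 0 w) q + pd 1 (pd 1 w) q = 0) ∧
      (∃ q ∈ V, ∃ q' ∈ V, w q ≠ w q')) ∧
    -- (ii)
    ((¬ IsKahlerOn (total V) (metric u w θ) (JJ u w θ) ∧
        IsAK2On (total V) (metric u w θ) (JJ u w θ)) ↔
      (∀ q ∈ V, pd 2 w q = 0 ∧ pd 2 u q = 0) ∧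
      (∀ q ∈ V, pd 0 (pd 0 w) q + pd 1 (pd 1 w) q = 0) ∧
      (∃ q ∈ V, ∃ q' ∈ V, w q ≠ w q') ∧
      (∀ q ∈ V, ¬ (pd 0 w q = 0 ∧ pd 1 w q = 0)) ∧
      (∃ c : ℝ, ∀ q ∈ V,
        u q = Real.log (pd 0 w q ^ 2 + pd 1 w q ^ 2) - 3 * Real.log (w q) + c)) ∧
    -- (i) and (ii) through functions on the projection `U` of `V` to the `(x, y)`-plane,
    -- when the vertical slices of `V` are connected
    ((∀ a b : ℝ, IsPreconnected {z : ℝ | ![a, b, z] ∈ V}) →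
      ((¬ IsKahlerOn (total V) (metric u w θ) (JJ u w θ) ∧
          IsAK3On (total V) (metric u w θ) (JJ u w θ)) ↔
        ∃ W F : (Fin 2 → ℝ) → ℝ,
          ContDiffOn ℝ ∞ W (prXY '' V) ∧ ContDiffOn ℝ ∞ F (prXY '' V) ∧
          (∀ q ∈ V, w q = W (prXY q)) ∧ (∀ q ∈ V, u q = F (prXY q)) ∧
          (∀ r ∈ prXY '' V, 0 < W r) ∧
          (∀ r ∈ prXY '' V, pd 0 (pd 0 W) r + pd 1 (pd 1 W) r = 0) ∧
          (∃ r ∈ prXY '' V, ∃ r' ∈ prXY '' V, W r ≠ W r')) ∧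
      ((¬ IsKahlerOn (total V) (metric u w θ) (JJ u w θ) ∧
          IsAK2On (total V) (metric u w θ) (JJ u w θ)) ↔
        ∃ W F : (Fin 2 → ℝ) → ℝ,
          ContDiffOn ℝ ∞ W (prXY '' V) ∧ ContDiffOn ℝ ∞ F (prXY '' V) ∧
          (∀ q ∈ V, w q = W (prXY q)) ∧ (∀ q ∈ V, u q = F (prXY q)) ∧
          (∀ r ∈ prXY '' V, 0 < W r) ∧
          (∀ r ∈ prXY '' V, pd 0 (pd 0 W) r + pd 1 (pd 1 W) r = 0) ∧
          (∃ r ∈ prXY '' V, ∃ r' ∈ prXY '' V, W r ≠ W r') ∧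
          (∀ r ∈ prXY '' V, ¬ (pd 0 W r = 0 ∧ pd 1 W r = 0)) ∧
          (∃ c : ℝ, ∀ r ∈ prXY '' V,
            F r = Real.log (pd 0 W r ^ 2 + pd 1 W r ^ 2) - 3 * Real.log (W r) + c))) := by
  have hVc := hVconn.isPreconnected
  have hAK := isAlmostKahler_iff hVopen hw hu hwpos hθ hθ0 hdθ
  have hK := isKahler_iff hVopen hw hu hwpos hθ hθ0 hdθ
  have dw := fun {q} (hq : q ∈ V) => differentiableAt_of_smooth hVopen hw hq
  have du := fun {q} (hq : q ∈ V) => differentiableAt_of_smooth hVopen hu hq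
  have hG₃ := gray₃On_iff hVopen hw hu hwpos heq hθ hθ0 hdθ
  have hG₂ := gray₂On_iff hVopen hw hu hwpos heq hθ hθ0 hdθ
  have hzu : (∀ q ∈ V, pd 2 w q = 0) →
      ((∀ q ∈ V, pd 2 u q = 0) ↔ ∀ q ∈ V, pd 2 (expw u w) q = 0) := fun hwz =>
    forall₂_congr fun q hq => pd_two_u_eq_zero_iff (dw hq) (du hq) (hwpos q hq) (hwz q hq)
  -- an almost Kähler structure satisfying the third Gray condition is Kähler or has `w_z = u_z = 0`
  have key : (∀ q ∈ V, pd 2 (expw u w) q = 0) →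
      ¬ IsKahlerOn (total V) (metric u w θ) (JJ u w θ) →
      (∀ q ∈ V, w q * pd 0 (pd 2 w) q = 2 * pd 2 w q * pd 0 w q ∧
        w q * pd 1 (pd 2 w) q = 2 * pd 2 w q * pd 1 w q) →
      (∀ q ∈ V, pd 2 w q = 0 ∧ pd 2 u q = 0) ∧
        (∀ q ∈ V, pd 0 (pd 0 w) q + pd 1 (pd 1 w) q = 0) ∧
        (∃ q ∈ V, ¬(pd 0 w q = 0 ∧ pd 1 w q = 0)) := by
    intro hz hnK h3
    have hharm := fun q (hq : q ∈ V) => harmonic_of_almostKahler hVopen heq hz hq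
    have hne : ∃ q ∈ V, ¬(pd 0 w q = 0 ∧ pd 1 w q = 0) := by
      by_contra! h
      exact hnK (hK.mpr ⟨hz, h⟩)
    have hwz := fun q (hq : q ∈ V) => pd_two_eq_zero hVopen hVc hw hwpos hharm h3 hne hq
    exact ⟨fun q hq => ⟨hwz q hq, (hzu hwz).mpr hz q hq⟩, hharm, hne⟩
  have back₃ : (∀ q ∈ V, pd 2 w q = 0) → ∀ q ∈ V,
      w q * pd 0 (pd 2 w) q = 2 * pd 2 w q * pd 0 w q ∧
        w q * pd 1 (pd 2 w) q = 2 * pd 2 w q * pd 1 w q := fun hwz q hq => by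
    rw [pd_eq_zero_of_eqOn hVopen hwz hq, pd_eq_zero_of_eqOn hVopen hwz hq, hwz q hq]
    simp
  have hi : (¬ IsKahlerOn (total V) (metric u w θ) (JJ u w θ) ∧
        IsAK3On (total V) (metric u w θ) (JJ u w θ)) ↔
      (∀ q ∈ V, pd 2 w q = 0 ∧ pd 2 u q = 0) ∧
      (∀ q ∈ V, pd 0 (pd 0 w) q + pd 1 (pd 1 w) q = 0) ∧
      (∃ q ∈ V, ∃ q' ∈ V, w q ≠ w q') := by
    constructor
    · rintro ⟨hnK, hA, hG⟩
      have hz := hAK.mp hA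
      obtain ⟨h1, h2, h3⟩ := key hz hnK ((hG₃ hz).mp hG)
      exact ⟨h1, h2, (exists_ne_iff hVopen hVc hw fun q hq => (h1 q hq).1).mpr h3⟩
    · rintro ⟨h1, h2, h3⟩
      have hwz := fun q hq => (h1 q hq).1
      have hz := (hzu hwz).mp fun q hq => (h1 q hq).2
      obtain ⟨q, hq, hne⟩ := (exists_ne_iff hVopen hVc hw hwz).mp h3
      exact ⟨fun h => hne ((hK.mp h).2 q hq), hAK.mpr hz, (hG₃ hz).mpr (back₃ hwz)⟩
  have hii : (¬ IsKahlerOn (total V) (metric u w θ) (JJ u w θ) ∧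
        IsAK2On (total V) (metric u w θ) (JJ u w θ)) ↔
      (∀ q ∈ V, pd 2 w q = 0 ∧ pd 2 u q = 0) ∧
      (∀ q ∈ V, pd 0 (pd 0 w) q + pd 1 (pd 1 w) q = 0) ∧
      (∃ q ∈ V, ∃ q' ∈ V, w q ≠ w q') ∧
      (∀ q ∈ V, ¬ (pd 0 w q = 0 ∧ pd 1 w q = 0)) ∧
      (∃ c : ℝ, ∀ q ∈ V,
        u q = Real.log (pd 0 w q ^ 2 + pd 1 w q ^ 2) - 3 * Real.log (w q) + c) := by
    constructor
    · rintro ⟨hnK, hA, hG⟩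
      have hz := hAK.mp hA
      have hG' := (hG₂ hz).mp hG
      obtain ⟨h1, h2, h3⟩ := key hz hnK fun q hq => (hG' q hq).1
      have hwz := fun q hq => (h1 q hq).1
      exact ⟨h1, h2, (exists_ne_iff hVopen hVc hw hwz).mpr h3,
        (gray₂_equations_iff hVopen hVc hVconn.nonempty hw hu hwpos h2 hwz
          fun q hq => (h1 q hq).2).mp ⟨h3, fun q hq => (hG' q hq).2⟩⟩
    · rintro ⟨h1, h2, h3, h4⟩
      have hwz := fun q hq => (h1 q hq).1
      have hz := (hzu hwz).mp fun q hq => (h1 q hq).2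
      obtain ⟨⟨q, hq, hne⟩, hE⟩ := (gray₂_equations_iff hVopen hVc hVconn.nonempty hw hu hwpos h2
        hwz fun q hq => (h1 q hq).2).mpr h4
      exact ⟨fun h => hne ((hK.mp h).2 q hq), hAK.mpr hz,
        (hG₂ hz).mpr fun q hq => ⟨back₃ hwz q hq, hE q hq⟩⟩
  refine ⟨⟨isAlmostHermitian hw hu hwpos hθ hθ0, fun p hp =>
    fundamentalForm_eq (hwpos _ hp) (hθ0 p hp)⟩, hAK, hK, hi, hii, fun hs => ⟨?_, ?_⟩⟩
  · rw [hi]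
    constructor
    · rintro ⟨h1, h2, q, hq, q', hq', hne⟩
      obtain ⟨W, hW, hWw⟩ := exists_descent hVopen hs hw fun q hq => (h1 q hq).1
      obtain ⟨F, hF, hFu⟩ := exists_descent hVopen hs hu fun q hq => (h1 q hq).2
      refine ⟨W, F, hW, hF, hWw, hFu, ?_, ?_, _, ⟨q, hq, rfl⟩, _, ⟨q', hq', rfl⟩, ?_⟩
      · rintro _ ⟨q, hq, rfl⟩
        exact hWw q hq ▸ hwpos q hq
      · rintro _ ⟨q, hq, rfl⟩
        rw [← laplacian_of_descent hVopen hW hWw hq, h2 q hq]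
      · rwa [← hWw q hq, ← hWw q' hq']
    · rintro ⟨W, F, hW, hF, hWw, hFu, -, h2, _, ⟨q, hq, rfl⟩, _, ⟨q', hq', rfl⟩, hne⟩
      refine ⟨fun q hq => ⟨(pd_of_descent hVopen hW hWw hq).2.2,
        (pd_of_descent hVopen hF hFu hq).2.2⟩, fun q hq => ?_, q, hq, q', hq', ?_⟩
      · rw [laplacian_of_descent hVopen hW hWw hq, h2 _ ⟨q, hq, rfl⟩]
      · rwa [hWw q hq, hWw q' hq']
  · rw [hii]
    constructor
    · rintro ⟨h1, h2, ⟨q, hq, q', hq', hne⟩, h4, c, hc⟩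
      obtain ⟨W, hW, hWw⟩ := exists_descent hVopen hs hw fun q hq => (h1 q hq).1
      obtain ⟨F, hF, hFu⟩ := exists_descent hVopen hs hu fun q hq => (h1 q hq).2
      refine ⟨W, F, hW, hF, hWw, hFu, ?_, ?_, ⟨_, ⟨q, hq, rfl⟩, _, ⟨q', hq', rfl⟩, ?_⟩, ?_, c, ?_⟩
      · rintro _ ⟨q, hq, rfl⟩
        exact hWw q hq ▸ hwpos q hq
      · rintro _ ⟨q, hq, rfl⟩
        rw [← laplacian_of_descent hVopen hW hWw hq, h2 q hq]
      · rwa [← hWw q hq, ← hWw q' hq']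
      · rintro _ ⟨q, hq, rfl⟩
        obtain ⟨e0, e1, -⟩ := pd_of_descent hVopen hW hWw hq
        rw [← e0, ← e1]
        exact h4 q hq
      · rintro _ ⟨q, hq, rfl⟩
        obtain ⟨e0, e1, -⟩ := pd_of_descent hVopen hW hWw hq
        rw [← e0, ← e1, ← hWw q hq, ← hFu q hq]
        exact hc q hq
    · rintro ⟨W, F, hW, hF, hWw, hFu, -, h2, ⟨_, ⟨q, hq, rfl⟩, _, ⟨q', hq', rfl⟩, hne⟩, h4, c, hc⟩
      refine ⟨fun q hq => ⟨(pd_of_descent hVopen hW hWw hq).2.2,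
        (pd_of_descent hVopen hF hFu hq).2.2⟩, fun q hq => ?_, ⟨q, hq, q', hq', ?_⟩,
        fun q hq => ?_, c, fun q hq => ?_⟩
      · rw [laplacian_of_descent hVopen hW hWw hq, h2 _ ⟨q, hq, rfl⟩]
      · rwa [hWw q hq, hWw q' hq']
      · obtain ⟨e0, e1, -⟩ := pd_of_descent hVopen hW hWw hq
        rw [e0, e1]
        exact h4 _ ⟨q, hq, rfl⟩
      · obtain ⟨e0, e1, -⟩ := pd_of_descent hVopen hW hWw hq
        rw [e0, e1, hWw q hq, hFu q hq]
        exact hc _ ⟨q, hq, rfl⟩
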